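/- Let $\mathrm{PGL}_2(\mathbb Z)$ act on $\widehat{\mathbb R}=\mathbb R\cup\{\infty\}$ by Möbius transformations; the orbit space $\widehat{\mathbb R}/\mathrm{PGL}_2(\mathbb Z)$ is the moduli space of real rank-two lattices, and $[x]$ denotes the class of $x$. Put $U(x)=1/x$, $V(x)=-x$, $K(x)=1-x$, $S(x)=-1/x$, $L(x)=1-1/x$, $T=LS$ (so $T(x)=x+1$ and $(L^2S)(x)=x/(x+1)$). Let $\mathbf j$ be Dyer's automorphism of $\mathrm{PGL}_2(\mathbb Z)$, the one with $U\mapsto U$, $V\mapsto UV$, $K\mapsto K$. Every $x\in\widehat{\mathbb R}$ is represented by an infinite word $S^{\varepsilon}W_0W_1W_2\cdots$ with $\varepsilon\in\{0,1\}$ and $W_i\in\{LS,\,L^2S\}$, in the sense that $x=\lim_n S^{\varepsilon}W_0\cdots W_{n-1}(1)$; the word is unique if $x$ is irrational, and there are exactly two words if $x$ is rational or $\infty$. Write $0$ for $LS$ and $1$ for $L^2S$. The (at rationals and $\infty$ two-valued) map $\mathbf j$ on $\widehat{\mathbb R}$ (jimm) sends the point represented by $S^{\varepsilon}a$, $a\in\{0,1\}^{\mathbb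 N}$, to the point represented by $S^{\varepsilon}(a\oplus\phi_\varepsilon)$, where $\oplus$ is termwise exclusive or, $\phi_0=010101\cdots$ and $\phi_1=101010\cdots$. **Proposition.** There is exactly one map $\iota$ of $\widehat{\mathbb R}/\mathrm{PGL}_2(\mathbb Z)$ to itself such that $\iota([x])=[y]$ for all $x\in\widehat{\mathbb R}$ and every value $y$ of $\mathbf j$ at $x$, and $\iota$ is an involution. For every $x\in\widehat{\mathbb R}$ the following are equivalent: 1. $[x]$ is a fixed point of $\iota$; 2. $x$ is the point represented by the infinite word $(\mathbf jM)\,M\,(\mathbf jM)\,M\cdots$ for some $M\in\mathrm{PGL}_2(\mathbb Z)$, i.e. for all but finitely many $y\in\widehat{\mathbb R}$ the finite initial products of this word, applied to $y$, converge to $x$; 3. $x$ is a fixed point of $(\mathbf jM)M$ for some $M\in\mathrm{PGL}_2(\mathbb Z)$ such that $(\mathbf jM)M$ has infinite order. For example, for every integer $k\ge 0$, the class of the number with the periodic continued fraction $[\overline{1_k,k+2}]$ (where $1_k$ stands for $k$ ones) is a fixed point of $\iota$, and it is the class of the point represented by the infinite word of item 2 for $M=T^{k+1}$. -/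

import Mathlib

open Filter Topology
open scoped MatrixGroups

namespace Jimm

/-! ### The extended modular group and its action on the extended real line -/

/-- The unit of `M₂(ℤ)` given by `[[a, b], [c, d]]`, with `ad - bc = e` and `e * e = 1`. -/
def glOf (a b c d e : ℤ) (h : a * d - b * c = e) (he : e * e = 1) : GL (Fin 2) ℤ where
  val := !![a, b; c, d]
  inv := !![e * d, -(e * b); -(e * c), e * a]
  val_inv := by
    subst h
    ext i j
    fin_cases i <;> fin_cases j <;> simp <;> linarith
  inv_val := by
    subst h
    ext i j
    fin_cases i <;> fin_cases j <;> simp <;> linarith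

/-- `U : x ↦ 1 / x`. -/
def genU : PGL(2, ℤ) := .mk (glOf 0 1 1 0 (-1) (by norm_num) (by norm_num))

/-- `V : x ↦ -x`. -/
def genV : PGL(2, ℤ) := .mk (glOf (-1) 0 0 1 (-1) (by norm_num) (by norm_num))

/-- `K : x ↦ 1 - x`. -/
def genK : PGL(2, ℤ) := .mk (glOf (-1) 1 0 1 (-1) (by norm_num) (by norm_num))

/-- `S : x ↦ -1 / x`. -/
def genS : PGL(2, ℤ) := .mk (glOf 0 (-1) 1 0 1 (by norm_num) (by norm_num))

/-- `L : x ↦ 1 - 1 / x`. -/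
def genL : PGL(2, ℤ) := .mk (glOf 1 (-1) 1 0 1 (by norm_num) (by norm_num))

/-- `T : x ↦ x + 1`. -/
def genT : PGL(2, ℤ) := .mk (glOf 1 1 0 1 1 (by norm_num) (by norm_num))

theorem mk_eq_of_matrix {A B : GL (Fin 2) ℤ} (h : A.val = B.val ∨ A.val = -B.val) :
    (Matrix.ProjGenLinGroup.mk A : PGL(2, ℤ)) = .mk B := by
  rw [Matrix.ProjGenLinGroup.mk_eq_mk_iff]
  rcases h with h | h
  · exact ⟨1, by simpa using Units.ext h⟩
  · refine ⟨-1, Units.ext ?_⟩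
    ext i j
    fin_cases i <;> fin_cases j <;> simp [h, Matrix.mul_apply]

theorem matrix_of_mk_eq {A B : GL (Fin 2) ℤ}
    (h : (Matrix.ProjGenLinGroup.mk A : PGL(2, ℤ)) = .mk B) :
    A.val = B.val ∨ A.val = -B.val := by
  rw [Matrix.ProjGenLinGroup.mk_eq_mk_iff] at h
  obtain ⟨u, rfl⟩ := h
  rcases Int.units_eq_one_or u with rfl | rfl
  · left; simp
  · right
    ext i j
    fin_cases i <;> fin_cases j <;> simp

theorem mul_entry (A B : GL (Fin 2) ℤ) (i j : Fin 2) :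
    (A * B).val i j = A.val i 0 * B.val 0 j + A.val i 1 * B.val 1 j := by
  simp [Matrix.mul_apply]

/-- `PGL₂(ℤ)` acts on `ℝ ∪ {∞}` by Möbius transformations. -/
noncomputable instance : MulAction PGL(2, ℤ) (OnePoint ℝ) :=
  .ofEndHom <| Matrix.ProjGenLinGroup.lift
    ((MulAction.toEndHom (M := GL (Fin 2) ℝ) (α := OnePoint ℝ)).comp
      (Matrix.GeneralLinearGroup.map (Int.castRingHom ℝ))) <| by
    ext u
    funext x
    rcases Int.units_eq_one_or u with rfl | rfl
    · simp
    · change (Matrix.GeneralLinearGroup.map (Int.castRingHom ℝ)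
        (Matrix.GeneralLinearGroup.scalar (Fin 2) (-1 : ℤˣ))) • x = x
      induction x using OnePoint.rec with
      | infty => simp [OnePoint.smul_infty_eq_ite]
      | coe x => simp [OnePoint.smul_some_eq_ite]

theorem mk_smul (A : GL (Fin 2) ℤ) (x : OnePoint ℝ) :
    (Matrix.ProjGenLinGroup.mk A : PGL(2, ℤ)) • x =
      Matrix.GeneralLinearGroup.map (Int.castRingHom ℝ) A • x := rfl

/-! ### The outer automorphism of `PGL₂(ℤ)` -/

theorem relUU : genU * genU = 1 := by
  simp only [genU, ← map_mul, ← Matrix.ProjGenLinGroup.mk_one]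
  exact mk_eq_of_matrix (by decide)

theorem relVV : genV * genV = 1 := by
  simp only [genV, ← map_mul, ← Matrix.ProjGenLinGroup.mk_one]
  exact mk_eq_of_matrix (by decide)

theorem relKK : genK * genK = 1 := by
  simp only [genK, ← map_mul, ← Matrix.ProjGenLinGroup.mk_one]
  exact mk_eq_of_matrix (by decide)

theorem relSS : genS * genS = 1 := by
  simp only [genS, ← map_mul, ← Matrix.ProjGenLinGroup.mk_one]
  exact mk_eq_of_matrix (by decide)

theorem relLLL : genL * genL * genL = 1 := by
  simp only [genL, ← map_mul, ← Matrix.ProjGenLinGroup.mk_one]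
  exact mk_eq_of_matrix (by decide)

theorem relUV : genU * genV = genS := by
  simp only [genU, genV, genS, ← map_mul]
  exact mk_eq_of_matrix (by decide)

theorem relVU : genV * genU = genS := by
  simp only [genU, genV, genS, ← map_mul]
  exact mk_eq_of_matrix (by decide)

theorem relSU : genS * genU = genU * genS := by
  simp only [genU, genS, ← map_mul]
  exact mk_eq_of_matrix (by decide)

theorem relKU : genK * genU = genL := by
  simp only [genU, genK, genL, ← map_mul]
  exact mk_eq_of_matrix (by decide)

theorem relLU : genL * genU = genU * (genL * genL) := by
  simp only [genU, genL, ← map_mul]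
  exact mk_eq_of_matrix (by decide)

theorem relLS : genL * genS = genT := by
  simp only [genT, genS, genL, ← map_mul]
  exact mk_eq_of_matrix (by decide)

theorem closure_UVK : Subgroup.closure {genU, genV, genK} = ⊤ := by
  set H := Subgroup.closure {genU, genV, genK} with hH
  have hU : genU ∈ H := Subgroup.subset_closure (by simp)
  have hV : genV ∈ H := Subgroup.subset_closure (by simp)
  have hK : genK ∈ H := Subgroup.subset_closure (by simp)
  have hS : genS ∈ H := relUV ▸ mul_mem hU hV
  have hT : genT ∈ H := relLS ▸ mul_mem (relKU ▸ mul_mem hK hU) hS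
  have key : ∀ B : Matrix.SpecialLinearGroup (Fin 2) ℤ,
      (Matrix.ProjGenLinGroup.mk (B : GL (Fin 2) ℤ) : PGL(2, ℤ)) ∈ H := by
    intro B
    have hB : B ∈ Subgroup.closure {ModularGroup.S, ModularGroup.T} := by
      rw [SpecialLinearGroup.SL2Z_generators]; trivial
    change Matrix.SpecialLinearGroup.toPGL B ∈ H
    refine (Subgroup.closure_le (H.comap Matrix.SpecialLinearGroup.toPGL)).2 ?_ hB
    rintro x (rfl | rfl)
    · have e : Matrix.SpecialLinearGroup.toPGL ModularGroup.S = genS := mk_eq_of_matrix (by decide)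
      change Matrix.SpecialLinearGroup.toPGL ModularGroup.S ∈ H
      rw [e]
      exact hS
    · have e : Matrix.SpecialLinearGroup.toPGL ModularGroup.T = genT := mk_eq_of_matrix (by decide)
      change Matrix.SpecialLinearGroup.toPGL ModularGroup.T ∈ H
      rw [e]
      exact hT
  have key' : ∀ A : GL (Fin 2) ℤ, A.val.det = 1 → Matrix.ProjGenLinGroup.mk A ∈ H := by
    intro A hA
    have e : (Matrix.ProjGenLinGroup.mk A : PGL(2, ℤ)) =
        .mk (Matrix.SpecialLinearGroup.toGL ⟨A.val, hA⟩) := mk_eq_of_matrix (Or.inl rfl)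
    rw [e]
    exact key _
  rw [eq_top_iff]
  intro M _
  induction M using Matrix.ProjGenLinGroup.induction_on with | mk A =>
  rcases Int.isUnit_eq_one_or ((Matrix.isUnit_iff_isUnit_det _).1 A.isUnit) with h | h
  · exact key' A h
  · have : Matrix.ProjGenLinGroup.mk (glOf (-1) 0 0 1 (-1) (by norm_num) (by norm_num) * A) ∈ H := by
      refine key' _ ?_
      rw [Units.val_mul, Matrix.det_mul, h]
      decide
    rw [map_mul] at this
    exact (Subgroup.mul_mem_cancel_left H hV).1 this

/-- The subgroup of `PGL₂(ℤ) × PGL₂(ℤ)` generated by `(U, U)`, `(V, UV)`, `(K, K)`; it is the graph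
of the automorphism `jimm` below. -/
def graph : Subgroup (PGL(2, ℤ) × PGL(2, ℤ)) :=
  Subgroup.closure {(genU, genU), (genV, genU * genV), (genK, genK)}

/-- The monoid generated by `LS` and `L²S`, inside the graph. -/
def graphMonoid : Submonoid (PGL(2, ℤ) × PGL(2, ℤ)) :=
  Submonoid.closure {(genL, genL) * (genS, genV), (genL, genL) * (genL, genL) * (genS, genV)}

theorem graph_normalForm {g : PGL(2, ℤ) × PGL(2, ℤ)} (hg : g ∈ graph) :
    ∃ x y w z, (x = 1 ∨ x = (genU, genU)) ∧ (y = 1 ∨ y = (genS, genV)) ∧ w ∈ graphMonoid ∧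
      (z = 1 ∨ z = (genL, genL) ∨ z = (genL, genL) * (genL, genL)) ∧ g = x * y * w * z := by
  set u : PGL(2, ℤ) × PGL(2, ℤ) := (genU, genU) with hu
  set s : PGL(2, ℤ) × PGL(2, ℤ) := (genS, genV) with hs
  set l : PGL(2, ℤ) × PGL(2, ℤ) := (genL, genL) with hl
  have uu : u * u = 1 := by simp [hu, relUU]
  have ss : s * s = 1 := by simp [hs, relSS, relVV]
  have lll : l * l * l = 1 := by simp [hl, relLLL]
  have su : s * u = u * s := by simp [hs, hu, relSU, relUV, relVU]
  have lu : l * u = u * (l * l) := by simp [hl, hu, relLU]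
  have llu : l * l * u = u * l := by
    rw [mul_assoc, lu, ← mul_assoc, lu, mul_assoc, mul_assoc l l, ← mul_assoc l l l, lll, mul_one]
  let P : PGL(2, ℤ) × PGL(2, ℤ) → Prop := fun g =>
    ∃ x y w z, (x = 1 ∨ x = u) ∧ (y = 1 ∨ y = s) ∧ w ∈ graphMonoid ∧
      (z = 1 ∨ z = l ∨ z = l * l) ∧ g = x * y * w * z
  have hP1 : P 1 := ⟨1, 1, 1, 1, by simp, by simp, one_mem _, by simp, by simp⟩
  have hPu : ∀ g, P g → P (u * g) := by
    rintro _ ⟨x, y, w, z, hx, hy, hw, hz, rfl⟩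
    rcases hx with rfl | rfl
    · exact ⟨u, y, w, z, by simp, hy, hw, hz, by simp only [mul_assoc, one_mul]⟩
    · exact ⟨1, y, w, z, by simp, hy, hw, hz, by simp only [← mul_assoc, uu, one_mul]⟩
  have hPs : ∀ g, P g → P (s * g) := by
    have h0 : ∀ y w z, (y = 1 ∨ y = s) → w ∈ graphMonoid → (z = 1 ∨ z = l ∨ z = l * l) →
        P (s * (y * w * z)) := by
      rintro y w z (rfl | rfl) hw hz
      · exact ⟨1, s, w, z, by simp, by simp, hw, hz, by simp only [mul_assoc, one_mul]⟩
      · exact ⟨1, 1, w, z, by simp, by simp, hw, hz, by simp only [← mul_assoc, ss, one_mul]⟩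
    rintro _ ⟨x, y, w, z, hx, hy, hw, hz, rfl⟩
    rcases hx with rfl | rfl
    · simpa only [one_mul] using h0 y w z hy hw hz
    · have := hPu _ (h0 y w z hy hw hz)
      simpa only [← mul_assoc, su] using this
  have m1 : l * s ∈ graphMonoid := Submonoid.subset_closure (by simp [hl, hs])
  have m2 : l * l * s ∈ graphMonoid := Submonoid.subset_closure (by simp [hl, hs])
  have hPl0 : ∀ y w z, (y = 1 ∨ y = s) → w ∈ graphMonoid → (z = 1 ∨ z = l ∨ z = l * l) →
      P (l * (y * w * z)) ∧ P (l * l * (y * w * z)) := by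
    rintro y w z (rfl | rfl) hw hz
    · simp only [one_mul]
      induction hw using Submonoid.closure_induction_left with
      | one =>
        rcases hz with rfl | rfl | rfl
        · exact ⟨⟨1, 1, 1, l, by simp, by simp, one_mem _, by simp, by simp⟩,
            ⟨1, 1, 1, l * l, by simp, by simp, one_mem _, by simp, by simp⟩⟩
        · exact ⟨⟨1, 1, 1, l * l, by simp, by simp, one_mem _, by simp, by simp⟩,
            ⟨1, 1, 1, 1, by simp, by simp, one_mem _, by simp, by simp [lll]⟩⟩
        · exact ⟨⟨1, 1, 1, 1, by simp, by simp, one_mem _, by simp,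
              by simp only [one_mul, ← mul_assoc, lll]⟩,
            ⟨1, 1, 1, l, by simp, by simp, one_mem _, by simp,
              by simp only [one_mul, ← mul_assoc, lll]⟩⟩
      | mul_left x hx w hw _ =>
        rcases hx with rfl | rfl
        · exact ⟨⟨1, 1, l * l * s * w, z, by simp, by simp, mul_mem m2 hw, hz,
              by simp only [one_mul, ← mul_assoc, hl, hs]⟩,
            ⟨1, s, w, z, by simp, by simp, hw, hz, by
              simp only [one_mul, ← mul_assoc]
              rw [lll, one_mul]⟩⟩
        · exact ⟨⟨1, s, w, z, by simp, by simp, hw, hz, by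
              simp only [one_mul, ← mul_assoc]
              rw [lll, one_mul]⟩,
            ⟨1, 1, l * s * w, z, by simp, by simp, mul_mem m1 hw, hz, by
              simp only [one_mul, ← mul_assoc]
              rw [lll, one_mul]⟩⟩
    · exact ⟨⟨1, 1, l * s * w, z, by simp, by simp, mul_mem m1 hw, hz,
          by simp only [one_mul, ← mul_assoc]⟩,
        ⟨1, 1, l * l * s * w, z, by simp, by simp, mul_mem m2 hw, hz,
          by simp only [one_mul, ← mul_assoc]⟩⟩
  have hPl : ∀ g, P g → P (l * g) := by
    rintro _ ⟨x, y, w, z, hx, hy, hw, hz, rfl⟩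
    rcases hx with rfl | rfl
    · simpa only [one_mul] using (hPl0 y w z hy hw hz).1
    · have := hPu _ (hPl0 y w z hy hw hz).2
      simpa only [← mul_assoc, lu] using this
  have hPv : ∀ g, P g → P ((genV, genU * genV) * g) := by
    intro g hg
    have e : ((genV, genU * genV) : PGL(2, ℤ) × PGL(2, ℤ)) = u * s := by
      simp [hu, hs, ← relUV, ← mul_assoc, relUU]
    rw [e, mul_assoc]
    exact hPu _ (hPs _ hg)
  have hPk : ∀ g, P g → P ((genK, genK) * g) := by
    intro g hg
    have e : ((genK, genK) : PGL(2, ℤ) × PGL(2, ℤ)) = l * u := by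
      simp [hu, hl, ← relKU, mul_assoc, relUU]
    rw [e, mul_assoc]
    exact hPl _ (hPu _ hg)
  have inv_U : genU⁻¹ = genU := inv_eq_of_mul_eq_one_left relUU
  have inv_K : genK⁻¹ = genK := inv_eq_of_mul_eq_one_left relKK
  have inv_V : genV⁻¹ = genV := inv_eq_of_mul_eq_one_left relVV
  have inv_S : genS⁻¹ = genS := inv_eq_of_mul_eq_one_left relSS
  change P g
  induction hg using Subgroup.closure_induction_left with
  | one => exact hP1
  | mul_left x hx y _ ih =>
    rcases hx with rfl | rfl | rfl
    exacts [hPu _ ih, hPv _ ih, hPk _ ih]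
  | inv_mul_cancel x hx y _ ih =>
    rcases hx with rfl | rfl | rfl
    · simpa [inv_U] using hPu _ ih
    · simpa [inv_V, relUV, inv_S] using hPv _ ih
    · simpa [inv_K] using hPk _ ih

theorem graphMonoid_fst {w : PGL(2, ℤ) × PGL(2, ℤ)} (hw : w ∈ graphMonoid) :
    w = 1 ∨ ∃ A : GL (Fin 2) ℤ, w.1 = .mk A ∧ 1 ≤ A.val 0 0 ∧ 1 ≤ A.val 1 1 ∧ 0 ≤ A.val 0 1 ∧
      0 ≤ A.val 1 0 ∧ 1 ≤ A.val 0 1 + A.val 1 0 := by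
  induction hw using Submonoid.closure_induction_left with
  | one => left; rfl
  | mul_left x hx w _ ih =>
    right
    have h1 : ((genL, genL) * (genS, genV) : PGL(2, ℤ) × PGL(2, ℤ)).1 =
        .mk (glOf 1 1 0 1 1 (by norm_num) (by norm_num)) := relLS
    have h2 : ((genL, genL) * (genL, genL) * (genS, genV) : PGL(2, ℤ) × PGL(2, ℤ)).1 =
        .mk (glOf 1 0 1 1 1 (by norm_num) (by norm_num)) := by
      simp only [Prod.fst_mul, genS, genL, ← map_mul]
      exact mk_eq_of_matrix (by decide)
    rcases ih with rfl | ⟨A, hA, h00, h11, h01, h10, h⟩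
    · rcases hx with rfl | rfl
      · exact ⟨_, by rw [mul_one, h1], by decide⟩
      · exact ⟨_, by rw [mul_one, h2], by decide⟩
    · rcases hx with rfl | rfl
      · refine ⟨_, by rw [Prod.fst_mul, h1, hA, ← map_mul], ?_⟩
        try simp only [mul_entry, glOf, Matrix.of_apply, Matrix.cons_val', Matrix.cons_val_zero,
          Matrix.cons_val_one, Matrix.cons_val_fin_one]
        omega
      · refine ⟨_, by rw [Prod.fst_mul, h2, hA, ← map_mul], ?_⟩
        try simp only [mul_entry, glOf, Matrix.of_apply, Matrix.cons_val', Matrix.cons_val_zero,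
          Matrix.cons_val_one, Matrix.cons_val_fin_one]
        omega

theorem graph_fst_eq_one {g : PGL(2, ℤ) × PGL(2, ℤ)} (hg : g ∈ graph) (h : g.1 = 1) : g = 1 := by
  obtain ⟨x, y, w, z, hx, hy, hw, hz, rfl⟩ := graph_normalForm hg
  rcases graphMonoid_fst hw with rfl | ⟨A, hA, h00, h11, h01, h10, h'⟩
  · have key : ∀ B : GL (Fin 2) ℤ, (Matrix.ProjGenLinGroup.mk B : PGL(2, ℤ)) = 1 →
        B.val = 1 ∨ B.val = -1 := fun B hB => by
      simpa using matrix_of_mk_eq (A := B) (B := 1) (by simpa using hB)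
    rcases hx with rfl | rfl <;> rcases hy with rfl | rfl <;> rcases hz with rfl | rfl | rfl <;>
      first
      | (simp; done)
      | (exfalso
         simp only [Prod.fst_mul, one_mul, mul_one, genU, genS, genL,
           ← map_mul] at h
         exact absurd (key _ h) (by decide))
  · exfalso
    have key : ∀ B : GL (Fin 2) ℤ, (Matrix.ProjGenLinGroup.mk B : PGL(2, ℤ)) = 1 →
        (B.val 0 0 = 1 ∧ B.val 0 1 = 0 ∧ B.val 1 0 = 0 ∧ B.val 1 1 = 1) ∨
        (B.val 0 0 = -1 ∧ B.val 0 1 = 0 ∧ B.val 1 0 = 0 ∧ B.val 1 1 = -1) := fun B hB => by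
      rcases matrix_of_mk_eq (A := B) (B := 1) (by simpa using hB) with h | h <;> simp [h]
    rcases hx with rfl | rfl <;> rcases hy with rfl | rfl <;> rcases hz with rfl | rfl | rfl <;>
      (simp only [Prod.fst_mul, one_mul, mul_one, genU, genS, genL, hA,
         ← map_mul] at h
       have := key _ h
       try simp only [mul_entry, glOf, Matrix.of_apply, Matrix.cons_val', Matrix.cons_val_zero,
         Matrix.cons_val_one, Matrix.cons_val_fin_one] at this
       omega)

theorem graph_swap {g : PGL(2, ℤ) × PGL(2, ℤ)} (hg : g ∈ graph) : g.swap ∈ graph := by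
  change g ∈ graph.comap (MulEquiv.prodComm.toMonoidHom)
  refine (Subgroup.closure_le _).2 ?_ hg
  rintro x (rfl | rfl | rfl)
  · exact Subgroup.subset_closure (by simp)
  · have : ((genU * genV, genV) : PGL(2, ℤ) × PGL(2, ℤ)) =
        (genU, genU) * (genV, genU * genV) := by
      simp [← mul_assoc, relUU]
    change ((genU * genV, genV) : PGL(2, ℤ) × PGL(2, ℤ)) ∈ graph
    rw [this]
    exact mul_mem (Subgroup.subset_closure (by simp)) (Subgroup.subset_closure (by simp))
  · exact Subgroup.subset_closure (by simp)

theorem graph_fst_surjective (M : PGL(2, ℤ)) : ∃ N, (M, N) ∈ graph := by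
  have h : Subgroup.closure {genU, genV, genK} ≤
      graph.map (MonoidHom.fst PGL(2, ℤ) PGL(2, ℤ)) := by
    refine (Subgroup.closure_le _).2 ?_
    rintro x (rfl | rfl | rfl)
    · exact ⟨(genU, genU), Subgroup.subset_closure (by simp), rfl⟩
    · exact ⟨(genV, genU * genV), Subgroup.subset_closure (by simp), rfl⟩
    · exact ⟨(genK, genK), Subgroup.subset_closure (by simp), rfl⟩
  rw [closure_UVK] at h
  obtain ⟨⟨M', N⟩, hg, rfl⟩ := h (Subgroup.mem_top M)
  exact ⟨N, hg⟩

theorem graph_fst_bijective :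
    Function.Bijective ((MonoidHom.fst PGL(2, ℤ) PGL(2, ℤ)).comp graph.subtype) := by
  refine ⟨(injective_iff_map_eq_one _).2 fun g hg => ?_, fun M => ?_⟩
  · exact Subtype.ext (graph_fst_eq_one g.2 hg)
  · obtain ⟨N, hN⟩ := graph_fst_surjective M
    exact ⟨⟨(M, N), hN⟩, rfl⟩

theorem graph_snd_bijective :
    Function.Bijective ((MonoidHom.snd PGL(2, ℤ) PGL(2, ℤ)).comp graph.subtype) := by
  refine ⟨(injective_iff_map_eq_one _).2 fun g hg => ?_, fun M => ?_⟩
  · have := graph_fst_eq_one (graph_swap g.2) hg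
    exact Subtype.ext (Prod.swap_injective this)
  · obtain ⟨N, hN⟩ := graph_fst_surjective M
    exact ⟨⟨(N, M), graph_swap hN⟩, rfl⟩

/-- Dyer's outer automorphism `jimm` of `PGL₂(ℤ)`, determined by `U ↦ U`, `V ↦ UV`, `K ↦ K`. -/
noncomputable def jimm : PGL(2, ℤ) ≃* PGL(2, ℤ) :=
  (MulEquiv.ofBijective _ graph_fst_bijective).symm.trans
    (MulEquiv.ofBijective _ graph_snd_bijective)

theorem jimm_eq_of_mem {M N : PGL(2, ℤ)} (h : (M, N) ∈ graph) : jimm M = N := by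
  have : (MulEquiv.ofBijective _ graph_fst_bijective).symm M = ⟨(M, N), h⟩ := by
    rw [MulEquiv.symm_apply_eq]; rfl
  rw [jimm, MulEquiv.trans_apply, this]; rfl

theorem jimm_U : jimm genU = genU := jimm_eq_of_mem (Subgroup.subset_closure (by simp))

theorem jimm_V : jimm genV = genU * genV := jimm_eq_of_mem (Subgroup.subset_closure (by simp))

theorem jimm_K : jimm genK = genK := jimm_eq_of_mem (Subgroup.subset_closure (by simp))

/-- The moduli space `(ℝ ∪ {∞}) / PGL₂(ℤ)` of real rank-two lattices. -/
noncomputable abbrev Moduli : Type := MulAction.orbitRel.Quotient PGL(2, ℤ) (OnePoint ℝ)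

/-- The class in the moduli space of a point of the extended real line. -/
noncomputable def cls (x : OnePoint ℝ) : Moduli := Quotient.mk _ x

/-! ### The ends of the Farey tree, the continued fraction map and the involution `jimm` -/

/-- An end of the Farey tree, seen from the base edge: an infinite non-backtracking path, i.e. an
infinite word `S^ε W₀ W₁ W₂ …` where each `Wᵢ` is `LS` (letter `false`) or `L²S` (letter `true`). -/
structure FareyEnd where
  /-- whether the word starts with `S` -/
  neg : Bool
  /-- the letters -/
  word : ℕ → Bool

/-- The group element of a letter: `LS : x ↦ x + 1` or `L²S : x ↦ x / (x + 1)`. -/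
def letter : Bool → PGL(2, ℤ)
  | false => genL * genS
  | true => genL * genL * genS

/-- The finite initial words of a path. -/
def FareyEnd.prefixWord (b : FareyEnd) : ℕ → PGL(2, ℤ)
  | 0 => if b.neg then genS else 1
  | n + 1 => b.prefixWord n * letter (b.word n)

/-- The end `b` represents the point `x` of the extended real line, i.e. `x` is the image of `b`
under the continued fraction map: `x` is the limit of the images of the base vertex under the
initial words of the path. (An irrational is represented by one end, a rational or `∞` by two.) -/
def FareyEnd.Represents (b : FareyEnd) (x : OnePoint ℝ) : Prop :=
  Tendsto (fun n => b.prefixWord n • ((1 : ℝ) : OnePoint ℝ)) atTop (𝓝 x)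

/-- The action of `jimm` on ends: termwise exclusive or with `010101…` for the words without a
leading `S`, and with `101010…` after a leading `S`. -/
def FareyEnd.jimm (b : FareyEnd) : FareyEnd where
  neg := b.neg
  word n := xor (b.word n) (xor b.neg (decide (n % 2 = 1)))

/-- `y` is a value of the map `jimm` of the extended real line at `x` (the map is single-valued at
irrationals and two-valued at rationals and at `∞`). -/
def IsJimmValue (x y : OnePoint ℝ) : Prop :=
  ∃ b : FareyEnd, b.Represents x ∧ b.jimm.Represents y

/-- `ι` is the map induced by `jimm` on the moduli space. -/
def IsInducedByJimm (ι : Moduli → Moduli) : Prop :=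
  ∀ x y : OnePoint ℝ, IsJimmValue x y → ι (cls x) = cls y

/-! ### The infinite words `(jimm M) M (jimm M) M …` and periodic continued fractions -/

/-- The partial products `1, jimm M, (jimm M) M, (jimm M) M (jimm M), …`. -/
noncomputable def altProd (M : PGL(2, ℤ)) : ℕ → PGL(2, ℤ)
  | 0 => 1
  | n + 1 => altProd M n * (if Even n then jimm M else M)

/-- `x` is the point represented by the infinite word `(jimm M) M (jimm M) M …`: the partial
products, applied to any point `y` of the extended real line outside a finite set (the repelling
directions), converge to `x`. -/
def IsAltWordPoint (M : PGL(2, ℤ)) (x : OnePoint ℝ) : Prop :=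
  ∀ᶠ y : OnePoint ℝ in cofinite, Tendsto (fun n => altProd M n • y) atTop (𝓝 x)

/-- The infinite simple continued fraction `[d₀, d₁, d₂, …]`. -/
noncomputable def contFrac (d : ℕ → ℕ) : GenContFract ℝ where
  h := d 0
  s := Stream'.Seq.ofStream fun i => ⟨1, d (i + 1)⟩

/-- The digits of `[\overline{1_k, k+2}]`: `k` ones followed by `k + 2`, repeated. -/
def onesDigits (k i : ℕ) : ℕ := if i % (k + 1) = k then k + 2 else 1

end Jimm

namespace Jimm

open OnePoint

/-! ### Möbius transformations in coordinates -/

/-! The point is equivariance: jimm of `g • x` is `jimm g` applied to jimm of `x`. The automorphism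
sends each letter W to W·U, and U exchanges the two letters when moved past one. Pushing all the U's
of a word to its right end complements every second letter, which is jimm on ends
(`jimm_prefixWord`). The relation `FareyEnd.Rel` records that `g` carries a tail of one end to a
tail of another, up to a possible complement (a twist by U) and with a shift `s` of the position.
Every `g` acts on ends in this sense (`exists_rel`), and jimm preserves the relation together with
its shift (`Rel.jimm`). Irrationals have one end; the two ends of `∞` have jimm images that differ
by a leading S, so the induced map on classes is well defined.

Dynamics enters through positive matrices: their infinite products contract the arc `[0, ∞]` to a
point (`exists_tendsto_partialProd`). Hence an element that preserves an end with positive shift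
attracts all but finitely many points to the point of that end (`Rel.isAttracting`), while one that
preserves an end with shift 0 has square 1.

If `[x]` is fixed, then `x` is irrational, because jimm destroys eventually constant words. So some
M carries the end `b` of `x` to `b.jimm` with a shift `s`, and `s ≠ 0` because `b` and `b.jimm`
differ by an alternating word and not by a constant one. Applying jimm, `jimm M` carries `b.jimm`
back to `b` with the same shift. Thus `jimm M * M` preserves `b` with shift `2 * s ≠ 0`: it fixes
`x` and has infinite order, and it or its inverse, which is again of this form, attracts to `x`.

Conversely, let `g = jimm M * M` have infinite order and fix `x`. Some power of `g` preserves an end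
`b` of `x` with nonzero shift. Since `jimm g = M * g * M⁻¹`, the ends `b.jimm` and `M b` are both
preserved by the same element with the same shift, so uniqueness of attracting points makes jimm of
`x` equal to `M • x`. -/

theorem mk_smul_coe (A : GL (Fin 2) ℤ) (x : ℝ) :
    (Matrix.ProjGenLinGroup.mk A : PGL(2, ℤ)) • (x : OnePoint ℝ) =
      if (A.val 1 0 : ℝ) * x + A.val 1 1 = 0 then ∞ else
        (((A.val 0 0 * x + A.val 0 1) / (A.val 1 0 * x + A.val 1 1) : ℝ) : OnePoint ℝ) := by
  rw [mk_smul, OnePoint.smul_some_eq_ite]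
  rfl

theorem mk_smul_infty (A : GL (Fin 2) ℤ) :
    (Matrix.ProjGenLinGroup.mk A : PGL(2, ℤ)) • (∞ : OnePoint ℝ) =
      if (A.val 1 0 : ℝ) = 0 then ∞ else ((A.val 0 0 / A.val 1 0 : ℝ) : OnePoint ℝ) := by
  rw [mk_smul, OnePoint.smul_infty_eq_ite]
  rfl

theorem genU_smul_coe (x : ℝ) :
    genU • (x : OnePoint ℝ) = if x = 0 then ∞ else ((x⁻¹ : ℝ) : OnePoint ℝ) := by
  rw [genU, mk_smul_coe]
  simp [glOf]

theorem genU_smul_infty : genU • (∞ : OnePoint ℝ) = (0 : ℝ) := by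
  rw [genU, mk_smul_infty]
  simp [glOf]

theorem genV_smul_coe (x : ℝ) : genV • (x : OnePoint ℝ) = ((-x : ℝ) : OnePoint ℝ) := by
  rw [genV, mk_smul_coe]
  simp [glOf]

theorem genV_smul_infty : genV • (∞ : OnePoint ℝ) = ∞ := by
  rw [genV, mk_smul_infty]
  simp [glOf]

theorem genK_smul_coe (x : ℝ) : genK • (x : OnePoint ℝ) = ((1 - x : ℝ) : OnePoint ℝ) := by
  rw [genK, mk_smul_coe]
  simp [glOf, neg_add_eq_sub]

theorem genK_smul_infty : genK • (∞ : OnePoint ℝ) = ∞ := by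
  rw [genK, mk_smul_infty]
  simp [glOf]

theorem genS_smul_coe (x : ℝ) :
    genS • (x : OnePoint ℝ) = if x = 0 then ∞ else ((-x⁻¹ : ℝ) : OnePoint ℝ) := by
  rw [genS, mk_smul_coe]
  simp [glOf, neg_div]

theorem genS_smul_infty : genS • (∞ : OnePoint ℝ) = (0 : ℝ) := by
  rw [genS, mk_smul_infty]
  simp [glOf]

theorem genT_smul_coe (x : ℝ) : genT • (x : OnePoint ℝ) = ((x + 1 : ℝ) : OnePoint ℝ) := by
  rw [genT, mk_smul_coe]
  simp [glOf]

theorem genT_smul_infty : genT • (∞ : OnePoint ℝ) = ∞ := by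
  rw [genT, mk_smul_infty]
  simp [glOf]

theorem letter_false : letter false = genT := relLS

theorem letter_true : letter true = .mk (glOf 1 0 1 1 1 (by norm_num) (by norm_num)) := by
  simp only [letter, genS, genL, ← map_mul]
  exact mk_eq_of_matrix (by decide)

theorem letter_true_smul_coe (x : ℝ) :
    letter true • (x : OnePoint ℝ) =
      if x + 1 = 0 then ∞ else ((x / (x + 1) : ℝ) : OnePoint ℝ) := by
  rw [letter_true, mk_smul_coe]
  simp [glOf]

theorem letter_true_smul_infty : letter true • (∞ : OnePoint ℝ) = (1 : ℝ) := by
  rw [letter_true, mk_smul_infty]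
  simp [glOf]

/-! ### Continuity -/

theorem continuous_genU_smul : Continuous fun x : OnePoint ℝ => genU • x := by
  rw [OnePoint.continuous_iff]
  constructor
  · rw [genU_smul_infty, coclosedCompact_eq_cocompact, ← Metric.cobounded_eq_cocompact]
    have h : Tendsto (fun x : ℝ => ((x⁻¹ : ℝ) : OnePoint ℝ)) (Bornology.cobounded ℝ)
        (𝓝 ((0 : ℝ) : OnePoint ℝ)) :=
      (OnePoint.continuous_coe.tendsto 0).comp tendsto_inv₀_cobounded
    refine h.congr' ?_
    filter_upwards [Bornology.eventually_ne_cobounded (0 : ℝ)] with x hx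
    simp [genU_smul_coe, hx]
  · rw [continuous_iff_continuousAt]
    intro x
    rcases eq_or_ne x 0 with rfl | hx
    · rw [ContinuousAt, ← nhdsNE_sup_pure, tendsto_sup]
      refine ⟨?_, ?_⟩
      · have h : Tendsto (fun x : ℝ => ((x⁻¹ : ℝ) : OnePoint ℝ)) (𝓝[≠] 0) (𝓝 ∞) := by
          refine OnePoint.tendsto_coe_infty.comp ?_
          rw [coclosedCompact_eq_cocompact, ← Metric.cobounded_eq_cocompact]
          exact tendsto_inv₀_nhdsNE_zero
        have e : genU • ((0 : ℝ) : OnePoint ℝ) = ∞ := by simp [genU_smul_coe]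
        simp only [e]
        refine h.congr' ?_
        filter_upwards [self_mem_nhdsWithin] with x (hx : x ≠ 0)
        rw [genU_smul_coe, if_neg hx]
      · exact tendsto_pure_nhds _ _
    · have h : ContinuousAt (fun x : ℝ => ((x⁻¹ : ℝ) : OnePoint ℝ)) x :=
        OnePoint.continuous_coe.continuousAt.comp (continuousAt_inv₀ hx)
      refine h.congr ?_
      filter_upwards [isOpen_ne.mem_nhds hx] with y hy
      rw [genU_smul_coe, if_neg hy]

theorem continuous_smul_of_homeomorph {g : PGL(2, ℤ)} (f : ℝ ≃ₜ ℝ)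
    (h : ∀ x : ℝ, g • (x : OnePoint ℝ) = (f x : ℝ)) (h' : g • (∞ : OnePoint ℝ) = ∞) :
    Continuous fun x : OnePoint ℝ => g • x := by
  have e : (fun x : OnePoint ℝ => g • x) = OnePoint.map f := by
    funext x
    induction x using OnePoint.rec with
    | infty => simpa using h'
    | coe x => simpa using h x
  rw [e]
  refine OnePoint.continuous_map f.continuous ?_
  rw [coclosedCompact_eq_cocompact]
  exact f.isClosedEmbedding.tendsto_cocompact

/-- Only generators need checking: V and K extend homeomorphisms of the line, and U is the one that
moves `∞`. -/
theorem continuous_smul (g : PGL(2, ℤ)) : Continuous fun x : OnePoint ℝ => g • x := by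
  have hU := continuous_genU_smul
  have hV : Continuous fun x : OnePoint ℝ => genV • x :=
    continuous_smul_of_homeomorph (Homeomorph.neg ℝ) genV_smul_coe genV_smul_infty
  have hK : Continuous fun x : OnePoint ℝ => genK • x :=
    continuous_smul_of_homeomorph (Homeomorph.subLeft (1 : ℝ)) genK_smul_coe genK_smul_infty
  have hg : g ∈ Subgroup.closure {genU, genV, genK} := closure_UVK ▸ Subgroup.mem_top g
  induction hg using Subgroup.closure_induction_left with
  | one => simpa using continuous_id'
  | mul_left x hx y _ ih =>
    simp only [mul_smul]
    rcases hx with rfl | rfl | rfl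
    exacts [hU.comp ih, hV.comp ih, hK.comp ih]
  | inv_mul_cancel x hx y _ ih =>
    simp only [mul_smul]
    rcases hx with rfl | rfl | rfl
    · rw [inv_eq_of_mul_eq_one_left relUU]; exact hU.comp ih
    · rw [inv_eq_of_mul_eq_one_left relVV]; exact hV.comp ih
    · rw [inv_eq_of_mul_eq_one_left relKK]; exact hK.comp ih

theorem tendsto_smul {α : Type*} {l : Filter α} {f : α → OnePoint ℝ} {x : OnePoint ℝ}
    (g : PGL(2, ℤ)) (h : Tendsto f l (𝓝 x)) : Tendsto (fun a => g • f a) l (𝓝 (g • x)) :=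
  ((continuous_smul g).tendsto x).comp h

theorem tendsto_smul_iff {α : Type*} {l : Filter α} {f : α → OnePoint ℝ} {x : OnePoint ℝ}
    (g : PGL(2, ℤ)) : Tendsto (fun a => g • f a) l (𝓝 (g • x)) ↔ Tendsto f l (𝓝 x) :=
  ⟨fun h => by simpa using tendsto_smul g⁻¹ h, tendsto_smul g⟩

/-! ### The cone of nonnegative points -/

/-- The closed arc `[0, ∞]` of the extended real line. -/
def cone : Set (OnePoint ℝ) := insert ∞ ((↑) '' Set.Ici (0 : ℝ))

theorem infty_mem_cone : (∞ : OnePoint ℝ) ∈ cone := Set.mem_insert _ _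

theorem coe_mem_cone {x : ℝ} : (x : OnePoint ℝ) ∈ cone ↔ 0 ≤ x := by
  simp [cone]

theorem isClosed_cone : IsClosed cone := by
  have : cone = ((↑) '' Set.Iio (0 : ℝ) : Set (OnePoint ℝ))ᶜ := by
    rw [OnePoint.compl_image_coe, Set.compl_Iio, cone, Set.union_comm]
    rfl
  rw [this, isClosed_compl_iff]
  exact OnePoint.isOpen_image_coe.2 isOpen_Iio

theorem genU_smul_mem_cone {x : OnePoint ℝ} (hx : x ∈ cone) : genU • x ∈ cone := by
  induction x using OnePoint.rec with
  | infty => rw [genU_smul_infty, coe_mem_cone]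
  | coe x =>
    rw [coe_mem_cone] at hx
    rw [genU_smul_coe]
    split_ifs
    · exact infty_mem_cone
    · rw [coe_mem_cone]; positivity

theorem genV_smul_mem_cone {x : OnePoint ℝ} (hx : x ∉ cone) : genV • x ∈ cone := by
  induction x using OnePoint.rec with
  | infty => exact absurd infty_mem_cone hx
  | coe x =>
    rw [coe_mem_cone] at hx
    rw [genV_smul_coe, coe_mem_cone]
    linarith

theorem genS_smul_mem_cone {x : OnePoint ℝ} (hx : x ∉ cone) : genS • x ∈ cone := by
  rw [← relUV, mul_smul]
  exact genU_smul_mem_cone (genV_smul_mem_cone hx)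

theorem eq_zero_or_infty_of_genS {x : OnePoint ℝ} (hx : x ∈ cone) (hx' : genS • x ∈ cone) :
    x = (0 : ℝ) ∨ x = ∞ := by
  induction x using OnePoint.rec with
  | infty => exact Or.inr rfl
  | coe x =>
    left
    rw [coe_mem_cone] at hx
    rw [genS_smul_coe] at hx'
    split_ifs at hx' with h
    · rw [h]
    · rw [coe_mem_cone] at hx'
      have : 0 < x⁻¹ := inv_pos.2 (lt_of_le_of_ne hx (Ne.symm h))
      linarith

/-! ### Positive elements -/

/-- The elements given by a nonnegative matrix that is not a permutation matrix. -/
def IsPositive (g : PGL(2, ℤ)) : Prop :=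
  ∃ A : GL (Fin 2) ℤ, g = .mk A ∧ 0 ≤ A.val 0 0 ∧ 0 ≤ A.val 0 1 ∧ 0 ≤ A.val 1 0 ∧
    0 ≤ A.val 1 1 ∧ 3 ≤ A.val 0 0 + A.val 0 1 + A.val 1 0 + A.val 1 1

theorem det_gl (A : GL (Fin 2) ℤ) :
    A.val 0 0 * A.val 1 1 - A.val 0 1 * A.val 1 0 = 1 ∨
      A.val 0 0 * A.val 1 1 - A.val 0 1 * A.val 1 0 = -1 := by
  have := Int.isUnit_eq_one_or ((Matrix.isUnit_iff_isUnit_det _).1 A.isUnit)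
  rwa [Matrix.det_fin_two] at this

/-- A nonzero determinant excludes a zero row or column. -/
theorem row_col_pos {a b c d : ℤ} (ha : 0 ≤ a) (hb : 0 ≤ b) (hc : 0 ≤ c) (hd : 0 ≤ d)
    (h : a * d - b * c = 1 ∨ a * d - b * c = -1) :
    1 ≤ a + b ∧ 1 ≤ c + d ∧ 1 ≤ a + c ∧ 1 ≤ b + d := by
  refine ⟨?_, ?_, ?_, ?_⟩ <;> by_contra! h'
  · obtain rfl : a = 0 := by omega
    obtain rfl : b = 0 := by omega
    simp at h
  · obtain rfl : c = 0 := by omega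
    obtain rfl : d = 0 := by omega
    simp at h
  · obtain rfl : a = 0 := by omega
    obtain rfl : c = 0 := by omega
    simp at h
  · obtain rfl : b = 0 := by omega
    obtain rfl : d = 0 := by omega
    simp at h

theorem IsPositive.mul {g h : PGL(2, ℤ)} (hg : IsPositive g) (hh : IsPositive h) :
    IsPositive (g * h) := by
  obtain ⟨A, rfl, a0, a1, a2, a3, a4⟩ := hg
  obtain ⟨B, rfl, b0, b1, b2, b3, b4⟩ := hh
  refine ⟨A * B, (map_mul _ _ _).symm, ?_⟩
  simp only [mul_entry]
  obtain ⟨-, -, h1, h2⟩ := row_col_pos a0 a1 a2 a3 (det_gl A)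
  obtain ⟨h3, h4, -, -⟩ := row_col_pos b0 b1 b2 b3 (det_gl B)
  refine ⟨by positivity, by positivity, by positivity, by positivity, ?_⟩
  -- The entry sum of the product is C₀R₀ + C₁R₁, with Cᵢ the column sums of `A` and Rᵢ the row sums
  -- of `B`; all are at least 1, and C₀ + C₁ ≥ 3.
  nlinarith

theorem IsPositive.mul_genU {g : PGL(2, ℤ)} (hg : IsPositive g) : IsPositive (g * genU) := by
  obtain ⟨A, rfl, a0, a1, a2, a3, a4⟩ := hg
  refine ⟨_, (map_mul _ _ _).symm, ?_⟩
  simp only [mul_entry, glOf, Matrix.of_apply, Matrix.cons_val', Matrix.cons_val_zero,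
    Matrix.cons_val_one, Matrix.cons_val_fin_one]
  omega

/-- Inversion swaps the diagonal and negates the off-diagonal entries, up to a global sign, and
conjugation by V undoes the negation. This controls backward orbits outside the cone. -/
theorem IsPositive.genV_conj_inv {g : PGL(2, ℤ)} (hg : IsPositive g) :
    IsPositive (genV * g⁻¹ * genV) := by
  obtain ⟨A, rfl, a0, a1, a2, a3, a4⟩ := hg
  have h : (A.val 1 1) * (A.val 0 0) - (A.val 0 1) * (A.val 1 0) =
    A.val 0 0 * A.val 1 1 - A.val 0 1 * A.val 1 0 := by ring
  refine ⟨glOf (A.val 1 1) (A.val 0 1) (A.val 1 0) (A.val 0 0) _ h ?_, ?_, ?_⟩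
  · rcases det_gl A with h | h <;> simp [h]
  · have e : (Matrix.ProjGenLinGroup.mk A : PGL(2, ℤ)) * (genV * .mk (glOf (A.val 1 1)
        (A.val 0 1) (A.val 1 0) (A.val 0 0) _ h (by rcases det_gl A with h | h <;> simp [h]))) =
        genV := by
      simp only [genV, ← map_mul]
      apply mk_eq_of_matrix
      rcases det_gl A with h | h
      · left
        ext i j
        fin_cases i <;> fin_cases j <;> simp [glOf, Matrix.mul_apply, Fin.sum_univ_two] <;> linarith
      · right
        ext i j
        fin_cases i <;> fin_cases j <;> simp [glOf, Matrix.mul_apply, Fin.sum_univ_two] <;> linarith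
    nth_rewrite 2 [← e]
    rw [mul_assoc, inv_mul_cancel_left, ← mul_assoc, relVV, one_mul]
  · simp only [glOf, Matrix.of_apply, Matrix.cons_val', Matrix.cons_val_zero,
      Matrix.cons_val_one, Matrix.cons_val_fin_one]
    omega

theorem isPositive_genT : IsPositive genT := ⟨_, rfl, by decide⟩

theorem isPositive_letter (a : Bool) : IsPositive (letter a) := by
  cases a
  · rw [letter_false]; exact isPositive_genT
  · rw [letter_true]; exact ⟨_, rfl, by decide⟩

theorem IsPositive.smul_mem_cone {g : PGL(2, ℤ)} (hg : IsPositive g) {x : OnePoint ℝ}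
    (hx : x ∈ cone) : g • x ∈ cone := by
  obtain ⟨A, rfl, a0, a1, a2, a3, -⟩ := hg
  have b0 : (0 : ℝ) ≤ A.val 0 0 := by exact_mod_cast a0
  have b1 : (0 : ℝ) ≤ A.val 0 1 := by exact_mod_cast a1
  have b2 : (0 : ℝ) ≤ A.val 1 0 := by exact_mod_cast a2
  have b3 : (0 : ℝ) ≤ A.val 1 1 := by exact_mod_cast a3
  induction x using OnePoint.rec with
  | infty =>
    rw [mk_smul_infty]
    split_ifs
    · exact infty_mem_cone
    · rw [coe_mem_cone]; positivity
  | coe x =>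
    rw [coe_mem_cone] at hx
    rw [mk_smul_coe]
    split_ifs
    · exact infty_mem_cone
    · rw [coe_mem_cone]; positivity

/-! ### Infinite products of positive elements -/

/-- The partial products of a sequence of group elements. -/
def partialProd (e : ℕ → PGL(2, ℤ)) : ℕ → PGL(2, ℤ)
  | 0 => 1
  | n + 1 => partialProd e n * e n

theorem partialProd_add (e : ℕ → PGL(2, ℤ)) (m n : ℕ) :
    partialProd e (m + n) = partialProd e m * partialProd (fun i => e (m + i)) n := by
  induction n with
  | zero => simp [partialProd]
  | succ n ih => rw [← add_assoc, partialProd, ih, partialProd, mul_assoc]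

theorem partialProd_const (g : PGL(2, ℤ)) (n : ℕ) : partialProd (fun _ => g) n = g ^ n := by
  induction n with
  | zero => rw [partialProd, pow_zero]
  | succ n ih => rw [partialProd, ih, pow_succ]

theorem partialProd_smul_mem_cone {e : ℕ → PGL(2, ℤ)} (he : ∀ n, IsPositive (e n)) (n : ℕ)
    {x : OnePoint ℝ} (hx : x ∈ cone) : partialProd e n • x ∈ cone := by
  induction n generalizing x with
  | zero => simpa [partialProd]
  | succ n ih => rw [partialProd, mul_smul]; exact ih ((he n).smul_mem_cone hx)

/-- A matrix with large positive bottom row maps the cone into a short interval. -/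
theorem exists_interval {A : GL (Fin 2) ℤ} {n : ℕ} (h0 : 1 ≤ A.val 1 0) (h1 : 1 ≤ A.val 1 1)
    (h : (n : ℤ) + 2 ≤ A.val 1 0 + A.val 1 1) :
    ∃ lo : ℝ, ∀ x ∈ cone, ∃ r : ℝ,
      (Matrix.ProjGenLinGroup.mk A : PGL(2, ℤ)) • x = (r : OnePoint ℝ) ∧ lo ≤ r ∧ r ≤ lo + 1 / ((n : ℝ) + 1) := by
  set a : ℝ := ((A.val 0 0 : ℤ) : ℝ) with ha
  set b : ℝ := ((A.val 0 1 : ℤ) : ℝ) with hb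
  set c : ℝ := ((A.val 1 0 : ℤ) : ℝ) with hc
  set d : ℝ := ((A.val 1 1 : ℤ) : ℝ) with hd
  have c1 : 1 ≤ c := by rw [hc]; exact_mod_cast h0
  have d1 : 1 ≤ d := by rw [hd]; exact_mod_cast h1
  have hcd : (n : ℝ) + 2 ≤ c + d := by rw [hc, hd]; exact_mod_cast h
  have hn : (0 : ℝ) ≤ n := n.cast_nonneg
  -- From `(c - 1) * (d - 1) ≥ 0` one gets `c * d ≥ c + d - 1`. The image of the cone lies between
  -- `a / c` and `b / d`, which are `1 / (c * d)` apart.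
  have hcd' : (n : ℝ) + 1 ≤ c * d := by nlinarith
  have hdet : a * d - b * c = 1 ∨ a * d - b * c = -1 := by
    rw [ha, hb, hc, hd]
    exact_mod_cast det_gl A
  have hw : 1 / (c * d) ≤ 1 / ((n : ℝ) + 1) := one_div_le_one_div_of_le (by positivity) hcd'
  have key : ∀ x ∈ cone, ∃ r : ℝ,
      (Matrix.ProjGenLinGroup.mk A : PGL(2, ℤ)) • x = (r : OnePoint ℝ) ∧
      min (a / c) (b / d) ≤ r ∧ r ≤ max (a / c) (b / d) := by
    intro x hx
    induction x using OnePoint.rec with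
    | infty =>
      refine ⟨a / c, ?_, min_le_left _ _, le_max_left _ _⟩
      rw [mk_smul_infty, if_neg (by rw [← hc]; positivity)]
    | coe x =>
      rw [coe_mem_cone] at hx
      have hp : 0 < c * x + d := by positivity
      refine ⟨(a * x + b) / (c * x + d), ?_, ?_, ?_⟩
      · rw [mk_smul_coe, if_neg hp.ne']
      · rw [min_le_iff, div_le_div_iff₀ (by positivity) hp, div_le_div_iff₀ (by positivity) hp]
        rcases hdet with h | h
        · right; nlinarith
        · left; nlinarith
      · rw [le_max_iff, div_le_div_iff₀ hp (by positivity), div_le_div_iff₀ hp (by positivity)]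
        rcases hdet with h | h
        · left; nlinarith
        · right; nlinarith
  refine ⟨min (a / c) (b / d), fun x hx => ?_⟩
  obtain ⟨r, hr, h1, h2⟩ := key x hx
  refine ⟨r, hr, h1, h2.trans ?_⟩
  have e : a / c - b / d = (a * d - b * c) / (c * d) := by
    rw [div_sub_div _ _ (by positivity) (by positivity)]; ring
  have hcd0 : 0 < 1 / (c * d) := by positivity
  rcases hdet with h | h
  · rw [h] at e
    rw [max_eq_left (by linarith), min_eq_right (by linarith)]
    linarith
  · rw [h, neg_div] at e
    rw [max_eq_right (by linarith), min_eq_left (by linarith)]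
    linarith

theorem letter_true_partialProd {e : ℕ → PGL(2, ℤ)} (he : ∀ n, IsPositive (e n)) (n : ℕ) :
    ∃ A : GL (Fin 2) ℤ, letter true * partialProd e n = .mk A ∧ 1 ≤ A.val 1 0 ∧ 1 ≤ A.val 1 1 ∧
      (n : ℤ) + 2 ≤ A.val 1 0 + A.val 1 1 := by
  induction n with
  | zero => exact ⟨_, by rw [partialProd, mul_one, letter_true], by decide⟩
  | succ n ih =>
    obtain ⟨A, hA, h0, h1, h⟩ := ih
    obtain ⟨B, hB, b0, b1, b2, b3, b4⟩ := he n
    refine ⟨A * B, by rw [partialProd, ← mul_assoc, hA, hB, map_mul], ?_⟩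
    simp only [mul_entry]
    obtain ⟨h3, h4, h5, h6⟩ := row_col_pos b0 b1 b2 b3 (det_gl B)
    push_cast
    -- The new bottom row sum is a combination of the row sums of `B` with coefficients at least 1;
    -- as these sums are positive and add up to at least 3, it grows by at least 1.
    refine ⟨by nlinarith, by nlinarith, by nlinarith⟩

/-- The partial products of a sequence of positive elements contract the cone to a point. -/
theorem exists_tendsto_partialProd {e : ℕ → PGL(2, ℤ)} (he : ∀ n, IsPositive (e n)) :
    ∃ p : OnePoint ℝ, Tendsto (fun x : ℕ × OnePoint ℝ => partialProd e x.1 • x.2)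
      (atTop ×ˢ 𝓟 cone) (𝓝 p) := by
  -- Prepending L²S keeps all images of the cone away from `∞`, so that the limit can be found by
  -- completeness of `ℝ`; the extra letter is cancelled at the end.
  have hI : ∀ n : ℕ, ∃ lo : ℝ, ∀ x ∈ cone, ∃ r : ℝ,
      (letter true * partialProd e n) • x = (r : OnePoint ℝ) ∧
      lo ≤ r ∧ r ≤ lo + 1 / ((n : ℝ) + 1) := fun n => by
    obtain ⟨A, hA, h0, h1, h⟩ := letter_true_partialProd he n
    rw [hA]
    exact exists_interval h0 h1 h
  choose lo hlo using hI
  have hmono : ∀ {m n : ℕ}, m ≤ n → ∀ x ∈ cone, ∃ r : ℝ,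
      (letter true * partialProd e n) • x = (r : OnePoint ℝ) ∧
      lo m ≤ r ∧ r ≤ lo m + 1 / ((m : ℝ) + 1) := by
    intro m n hmn x hx
    obtain ⟨k, rfl⟩ := Nat.exists_eq_add_of_le hmn
    rw [partialProd_add, ← mul_assoc, mul_smul]
    exact hlo m _ (partialProd_smul_mem_cone (fun i => he _) k hx)
  choose f hf hf0 hf1 using fun n => hlo n ∞ infty_mem_cone
  have hfm : ∀ {m n : ℕ}, m ≤ n → lo m ≤ f n ∧ f n ≤ lo m + 1 / ((m : ℝ) + 1) := by
    intro m n hmn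
    obtain ⟨r, hr, h⟩ := hmono hmn ∞ infty_mem_cone
    rw [hf n, OnePoint.coe_eq_coe] at hr
    rwa [hr]
  have hb : Tendsto (fun n : ℕ => 1 / ((n : ℝ) + 1)) atTop (𝓝 0) :=
    tendsto_one_div_add_atTop_nhds_zero_nat
  have hc : CauchySeq f := by
    refine cauchySeq_of_le_tendsto_0' (fun n : ℕ => 1 / ((n : ℝ) + 1)) (fun m n hmn => ?_) hb
    have h1 := hfm hmn
    have h2 := hfm (le_refl m)
    rw [Real.dist_eq, abs_le]
    constructor <;> linarith
  obtain ⟨p, hp⟩ := cauchySeq_tendsto_of_complete hc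
  refine ⟨(letter true)⁻¹ • (p : OnePoint ℝ), ?_⟩
  rw [← tendsto_smul_iff (letter true), smul_inv_smul]
  simp only [← mul_smul]
  -- The real coordinate; the default 0 at `∞` is never taken on the cone.
  let F : ℕ × OnePoint ℝ → ℝ := fun x =>
    ((letter true * partialProd e x.1) • x.2).elim 0 id
  have hF : ∀ᶠ x : ℕ × OnePoint ℝ in atTop ×ˢ 𝓟 cone,
      (letter true * partialProd e x.1) • x.2 = (F x : OnePoint ℝ) ∧
        dist (F x) (f x.1) ≤ 1 / ((x.1 : ℝ) + 1) := by
    have : ∀ᶠ x : ℕ × OnePoint ℝ in atTop ×ˢ 𝓟 cone, x.2 ∈ cone :=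
      tendsto_snd.eventually (mem_principal_self cone)
    filter_upwards [this] with x hx
    obtain ⟨r, hr, h1, h2⟩ := hlo x.1 x.2 hx
    have hFr : F x = r := by simp [F, hr]
    have h3 := hfm (le_refl x.1)
    refine ⟨by rw [hr, hFr], ?_⟩
    rw [hFr, Real.dist_eq, abs_le]
    constructor <;> linarith
  have hF' : Tendsto F (atTop ×ˢ 𝓟 cone) (𝓝 p) := by
    have h1 : Tendsto (fun x : ℕ × OnePoint ℝ => f x.1) (atTop ×ˢ 𝓟 cone) (𝓝 p) :=
      hp.comp tendsto_fst
    have h2 : Tendsto (fun x : ℕ × OnePoint ℝ => 1 / ((x.1 : ℝ) + 1)) (atTop ×ˢ 𝓟 cone) (𝓝 0) :=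
      hb.comp tendsto_fst
    refine h1.congr_dist ?_
    refine squeeze_zero' (Eventually.of_forall fun _ => dist_nonneg) ?_ h2
    filter_upwards [hF] with x hx
    rw [dist_comm]
    exact hx.2
  refine ((OnePoint.continuous_coe.tendsto p).comp hF').congr' ?_
  filter_upwards [hF] with x hx
  exact hx.1.symm

/-! ### Points represented by words -/

/-- The point represented by a word in the letters `LS` and `L²S`. -/
def WordRepresents (w : ℕ → Bool) (x : OnePoint ℝ) : Prop :=
  Tendsto (fun n => partialProd (fun i => letter (w i)) n • ((1 : ℝ) : OnePoint ℝ)) atTop (𝓝 x)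

theorem one_mem_cone : ((1 : ℝ) : OnePoint ℝ) ∈ cone := coe_mem_cone.2 zero_le_one

/-- Convergence is uniform over the cone, so the starting point may vary with `n`. -/
theorem tendsto_of_tendsto_cone {e : ℕ → PGL(2, ℤ)} {p : OnePoint ℝ}
    (h : Tendsto (fun x : ℕ × OnePoint ℝ => partialProd e x.1 • x.2) (atTop ×ˢ 𝓟 cone) (𝓝 p))
    {f : ℕ → OnePoint ℝ} (hf : ∀ n, f n ∈ cone) :
    Tendsto (fun n => partialProd e n • f n) atTop (𝓝 p) :=
  h.comp (tendsto_id.prodMk (tendsto_principal.2 (Eventually.of_forall hf)))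

theorem exists_wordRepresents (w : ℕ → Bool) : ∃ x, WordRepresents w x := by
  obtain ⟨p, hp⟩ := exists_tendsto_partialProd (fun i => isPositive_letter (w i))
  exact ⟨p, tendsto_of_tendsto_cone hp fun _ => one_mem_cone⟩

theorem WordRepresents.mem_cone {w : ℕ → Bool} {x : OnePoint ℝ} (hx : WordRepresents w x) :
    x ∈ cone :=
  isClosed_cone.mem_of_tendsto hx <| Eventually.of_forall fun n =>
    partialProd_smul_mem_cone (fun _ => isPositive_letter _) n one_mem_cone

theorem WordRepresents.tail {w : ℕ → Bool} {x : OnePoint ℝ} (hx : WordRepresents w x) :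
    WordRepresents (fun n => w (n + 1)) ((letter (w 0))⁻¹ • x) := by
  rw [WordRepresents, ← tendsto_smul_iff (letter (w 0)), smul_inv_smul]
  refine ((tendsto_add_atTop_iff_nat 1).2 hx).congr fun n => ?_
  rw [← mul_smul, add_comm n 1, partialProd_add]
  simp [partialProd, add_comm]

/-- LS maps the cone onto `[1, ∞]` and L²S maps it onto `[0, 1]`. -/
theorem exists_letter_smul {x : OnePoint ℝ} (hx : x ∈ cone) :
    ∃ a, ∃ y ∈ cone, letter a • y = x := by
  induction x using OnePoint.rec with
  | infty => exact ⟨false, ∞, infty_mem_cone, by rw [letter_false, genT_smul_infty]⟩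
  | coe x =>
    rw [coe_mem_cone] at hx
    rcases le_or_gt 1 x with h | h
    · refine ⟨false, ((x - 1 : ℝ) : OnePoint ℝ), coe_mem_cone.2 (by linarith), ?_⟩
      rw [letter_false, genT_smul_coe, sub_add_cancel]
    · have h' : 0 < 1 - x := by linarith
      have e : x / (1 - x) + 1 = 1 / (1 - x) := by field_simp; ring
      refine ⟨true, ((x / (1 - x) : ℝ) : OnePoint ℝ), coe_mem_cone.2 (by positivity), ?_⟩
      rw [letter_true_smul_coe, e, if_neg (by positivity)]
      congr 1
      field_simp

theorem exists_word_of_mem_cone {x : OnePoint ℝ} (hx : x ∈ cone) : ∃ w, WordRepresents w x := by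
  choose a f hf haf using fun y : cone => exists_letter_smul y.2
  let g : cone → cone := fun y => ⟨f y, hf y⟩
  let w : ℕ → Bool := fun n => a (g^[n] ⟨x, hx⟩)
  -- The word is read off by repeatedly stripping a letter. The remainders stay in the cone, so
  -- contraction identifies the limit of the initial words with `x`.
  have key : ∀ n, partialProd (fun i => letter (w i)) n • (g^[n] ⟨x, hx⟩ : OnePoint ℝ) = x := by
    intro n
    induction n with
    | zero => simp [partialProd]
    | succ n ih =>
      rw [partialProd, mul_smul, Function.iterate_succ_apply']
      change _ • letter (a (g^[n] ⟨x, hx⟩)) • f (g^[n] ⟨x, hx⟩) = x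
      rw [haf, ih]
  obtain ⟨p, hp⟩ := exists_tendsto_partialProd (fun i => isPositive_letter (w i))
  have h1 := tendsto_of_tendsto_cone hp (f := fun n => g^[n] ⟨x, hx⟩) fun n => (g^[n] ⟨x, hx⟩).2
  simp only [key] at h1
  rw [tendsto_nhds_unique tendsto_const_nhds h1]
  exact ⟨w, tendsto_of_tendsto_cone hp fun _ => one_mem_cone⟩

/-! ### Rational points -/

/-- The points of `ℚ ∪ {∞}`, as the orbit of `∞`. -/
def IsRat (x : OnePoint ℝ) : Prop := ∃ g : PGL(2, ℤ), g • ∞ = x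

theorem IsRat.smul {x : OnePoint ℝ} (hx : IsRat x) (g : PGL(2, ℤ)) : IsRat (g • x) := by
  obtain ⟨h, rfl⟩ := hx
  exact ⟨g * h, mul_smul _ _ _⟩

theorem isRat_smul_iff {x : OnePoint ℝ} (g : PGL(2, ℤ)) : IsRat (g • x) ↔ IsRat x :=
  ⟨fun h => by simpa using h.smul g⁻¹, fun h => h.smul g⟩

theorem isRat_infty : IsRat ∞ := ⟨1, one_smul _ _⟩

theorem isRat_zero : IsRat ((0 : ℝ) : OnePoint ℝ) := ⟨genU, genU_smul_infty⟩

theorem isRat_one : IsRat ((1 : ℝ) : OnePoint ℝ) := by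
  simpa [genT_smul_coe] using isRat_zero.smul genT

theorem letter_false_smul_of_mem_cone {x : OnePoint ℝ} (hx : x ∈ cone) :
    letter false • x = ∞ ∨ ∃ r : ℝ, letter false • x = r ∧ 1 ≤ r := by
  rw [letter_false]
  induction x using OnePoint.rec with
  | infty => exact Or.inl genT_smul_infty
  | coe x =>
    rw [coe_mem_cone] at hx
    exact Or.inr ⟨x + 1, genT_smul_coe x, by linarith⟩

theorem letter_true_smul_of_mem_cone {x : OnePoint ℝ} (hx : x ∈ cone) :
    ∃ r : ℝ, letter true • x = r ∧ r ≤ 1 := by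
  induction x using OnePoint.rec with
  | infty => exact ⟨1, letter_true_smul_infty, le_rfl⟩
  | coe x =>
    rw [coe_mem_cone] at hx
    have h : 0 < x + 1 := by linarith
    refine ⟨x / (x + 1), by rw [letter_true_smul_coe, if_neg h.ne'], ?_⟩
    rw [div_le_one h]
    linarith

/-- The images of the cone under the two letters meet only in 1; this is the source of
non-uniqueness of words. -/
theorem isRat_of_letter_smul_eq {x y : OnePoint ℝ} (hx : x ∈ cone) (hy : y ∈ cone)
    (h : letter false • x = letter true • y) : IsRat (letter false • x) := by
  obtain ⟨r, hr, hr1⟩ := letter_true_smul_of_mem_cone hy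
  rcases letter_false_smul_of_mem_cone hx with h' | ⟨s, hs, hs1⟩
  · rw [h']; exact isRat_infty
  · rw [h, hr] at hs
    rw [OnePoint.coe_eq_coe] at hs
    rw [h, hr, show r = 1 by linarith]
    exact isRat_one

theorem WordRepresents.head_eq {w w' : ℕ → Bool} {x : OnePoint ℝ} (hw : WordRepresents w x)
    (hw' : WordRepresents w' x) (hx : ¬ IsRat x) : w 0 = w' 0 := by
  have h := hw.tail.mem_cone
  have h' := hw'.tail.mem_cone
  by_contra hne
  apply hx
  rcases h0 : w 0 with _ | _ <;> rcases h0' : w' 0 with _ | _ <;> rw [h0] at h <;> rw [h0'] at h'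
  · exact absurd (h0.trans h0'.symm) hne
  · simpa using isRat_of_letter_smul_eq h h' (by simp)
  · simpa using isRat_of_letter_smul_eq h' h (by simp)
  · exact absurd (h0.trans h0'.symm) hne

theorem WordRepresents.word_unique {w w' : ℕ → Bool} {x : OnePoint ℝ} (hw : WordRepresents w x)
    (hw' : WordRepresents w' x) (hx : ¬ IsRat x) : w = w' := by
  funext n
  induction n generalizing w w' x with
  | zero => exact hw.head_eq hw' hx
  | succ n ih =>
    have h := hw.tail
    rw [hw.head_eq hw' hx] at h
    exact ih h hw'.tail ((isRat_smul_iff _).not.2 hx)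

theorem WordRepresents.eq_false_of_infty {w : ℕ → Bool} (hw : WordRepresents w ∞) (n : ℕ) :
    w n = false := by
  have h0 : w 0 = false := by
    by_contra h
    have h' := hw.tail.mem_cone
    rw [Bool.eq_true_of_not_eq_false h] at h'
    obtain ⟨r, hr, -⟩ := letter_true_smul_of_mem_cone h'
    simp at hr
  induction n generalizing w with
  | zero => exact h0
  | succ n ih =>
    have e : (letter false)⁻¹ • (∞ : OnePoint ℝ) = ∞ := by
      rw [inv_smul_eq_iff, letter_false, genT_smul_infty]
    have h := hw.tail
    rw [h0, e] at h
    refine ih h ?_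
    by_contra h1
    have h' := h.tail.mem_cone
    simp only [Bool.eq_true_of_not_eq_false h1] at h'
    obtain ⟨r, hr, -⟩ := letter_true_smul_of_mem_cone h'
    simp at hr

theorem WordRepresents.head_of_zero {w : ℕ → Bool} (hw : WordRepresents w (0 : ℝ)) :
    w 0 = true := by
  by_contra h
  have h' := hw.tail.mem_cone
  rw [Bool.eq_false_of_not_eq_true h] at h'
  rcases letter_false_smul_of_mem_cone h' with h | ⟨r, hr, h1⟩
  · simp at h
  · rw [smul_inv_smul, OnePoint.coe_eq_coe] at hr
    linarith

theorem WordRepresents.eq_true_of_zero {w : ℕ → Bool} (hw : WordRepresents w (0 : ℝ)) (n : ℕ) :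
    w n = true := by
  induction n generalizing w with
  | zero => exact hw.head_of_zero
  | succ n ih =>
    have e : (letter true)⁻¹ • ((0 : ℝ) : OnePoint ℝ) = (0 : ℝ) := by
      rw [inv_smul_eq_iff, letter_true_smul_coe]
      simp
    have h := hw.tail
    rw [hw.head_of_zero, e] at h
    exact ih h

/-! ### Ends -/

theorem FareyEnd.prefixWord_add (b : FareyEnd) (m n : ℕ) :
    b.prefixWord (m + n) =
      b.prefixWord m * partialProd (fun i => letter (b.word (m + i))) n := by
  induction n with
  | zero => simp [partialProd]
  | succ n ih => rw [← add_assoc, prefixWord, ih, partialProd, mul_assoc]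

theorem FareyEnd.represents_iff {b : FareyEnd} {x : OnePoint ℝ} :
    b.Represents x ↔ WordRepresents b.word ((b.prefixWord 0)⁻¹ • x) := by
  rw [WordRepresents, ← tendsto_smul_iff (b.prefixWord 0), smul_inv_smul, Represents]
  refine tendsto_congr fun n => ?_
  have h := b.prefixWord_add 0 n
  simp only [zero_add] at h
  rw [← mul_smul, h]

theorem FareyEnd.exists_represents (b : FareyEnd) : ∃ x, b.Represents x := by
  obtain ⟨x, hx⟩ := exists_wordRepresents b.word
  exact ⟨b.prefixWord 0 • x, by rwa [represents_iff, inv_smul_smul]⟩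

theorem FareyEnd.Represents.unique {b : FareyEnd} {x y : OnePoint ℝ} (hx : b.Represents x)
    (hy : b.Represents y) : x = y := tendsto_nhds_unique hx hy

theorem genS_inv : genS⁻¹ = genS := inv_eq_of_mul_eq_one_left relSS

theorem exists_end (x : OnePoint ℝ) : ∃ b : FareyEnd, b.Represents x := by
  by_cases hx : x ∈ cone
  · obtain ⟨w, hw⟩ := exists_word_of_mem_cone hx
    refine ⟨⟨false, w⟩, FareyEnd.represents_iff.2 ?_⟩
    simpa [FareyEnd.prefixWord] using hw
  · obtain ⟨w, hw⟩ := exists_word_of_mem_cone (genS_smul_mem_cone hx)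
    refine ⟨⟨true, w⟩, FareyEnd.represents_iff.2 ?_⟩
    simpa [FareyEnd.prefixWord, genS_inv] using hw

theorem isRat_of_genS_mem_cone {x : OnePoint ℝ} (hx : x ∈ cone) (hx' : genS • x ∈ cone) :
    IsRat x := by
  rcases eq_zero_or_infty_of_genS hx hx' with rfl | rfl
  exacts [isRat_zero, isRat_infty]

theorem FareyEnd.Represents.end_unique {b b' : FareyEnd} {x : OnePoint ℝ} (h : b.Represents x)
    (h' : b'.Represents x) (hx : ¬ IsRat x) : b = b' := by
  rw [represents_iff] at h h'
  have hneg : b.neg = b'.neg := by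
    by_contra hne
    apply hx
    have h1 := h.mem_cone
    have h2 := h'.mem_cone
    rcases h0 : b.neg with _ | _ <;> rcases h0' : b'.neg with _ | _ <;>
      simp only [prefixWord, h0, h0', genS_inv, inv_one, one_smul, if_true, if_false,
        Bool.false_eq_true] at h1 h2
    · exact absurd (h0.trans h0'.symm) hne
    · exact isRat_of_genS_mem_cone h1 h2
    · exact isRat_of_genS_mem_cone h2 h1
    · exact absurd (h0.trans h0'.symm) hne
  have hp : b.prefixWord 0 = b'.prefixWord 0 := by simp [prefixWord, hneg]
  rw [hp] at h
  have hw := h.word_unique h' ((isRat_smul_iff _).not.2 hx)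
  cases b
  cases b'
  simp_all

/-- The end `LS LS LS …` of `∞`. -/
def endInfty : FareyEnd := ⟨false, fun _ => false⟩

/-- The end `S L²S L²S L²S …` of `∞`. -/
def endInfty' : FareyEnd := ⟨true, fun _ => true⟩

theorem FareyEnd.Represents.eq_of_infty {b : FareyEnd} (h : b.Represents ∞) :
    b = endInfty ∨ b = endInfty' := by
  rw [represents_iff] at h
  obtain ⟨ε, w⟩ := b
  rcases ε with _ | _
  · left
    simp only [prefixWord, Bool.false_eq_true, if_false, inv_one, one_smul] at h
    rw [endInfty, funext h.eq_false_of_infty]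
  · right
    simp only [prefixWord, if_true, genS_inv, genS_smul_infty] at h
    rw [endInfty', funext h.eq_true_of_zero]

/-! ### Twists by `U` -/

/-- `U` or the identity. -/
def twist (d : Bool) : PGL(2, ℤ) := if d then genU else 1

theorem twist_mul_twist (a b : Bool) : twist a * twist b = twist (xor a b) := by
  cases a <;> cases b <;> simp [twist, relUU]

theorem genU_inv : genU⁻¹ = genU := inv_eq_of_mul_eq_one_left relUU

theorem twist_inv (d : Bool) : (twist d)⁻¹ = twist d := by
  cases d <;> simp [twist, genU_inv]

theorem twist_mul_self (d : Bool) : twist d * twist d = 1 := by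
  rw [twist_mul_twist, Bool.xor_self]; rfl

theorem twist_smul_one (d : Bool) : twist d • ((1 : ℝ) : OnePoint ℝ) = (1 : ℝ) := by
  cases d <;> simp [twist, genU_smul_coe]

/-- U commutes with S and conjugates L to L². -/
theorem letter_mul_genU (a : Bool) : letter a * genU = genU * letter (!a) := by
  have h : genL * genL * genU = genU * genL := by
    rw [mul_assoc, relLU, ← mul_assoc, relLU, mul_assoc, mul_assoc genL genL,
      ← mul_assoc genL genL genL, relLLL, mul_one]
  cases a
  · simp only [letter, Bool.not_false]
    rw [mul_assoc, relSU, ← mul_assoc, relLU, mul_assoc, mul_assoc]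
  · simp only [letter, Bool.not_true]
    rw [mul_assoc, relSU, ← mul_assoc, h, mul_assoc]

theorem twist_mul_letter (d a : Bool) : twist d * letter a = letter (xor d a) * twist d := by
  cases d
  · simp [twist]
  · simp [twist, letter_mul_genU]

theorem FareyEnd.prefixWord_zero_mul_genU (b : FareyEnd) :
    genU * b.prefixWord 0 = b.prefixWord 0 * genU := by
  rcases h : b.neg <;> simp [prefixWord, h, relSU]

/-! ### The automorphism `jimm` on words -/

theorem jimm_S : jimm genS = genS * genU := by
  rw [← relUV, map_mul, jimm_U, jimm_V, ← mul_assoc, relUU, one_mul, relUV, relSU, ← relUV,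
    ← mul_assoc, relUU, one_mul]

theorem jimm_L : jimm genL = genL := by rw [← relKU, map_mul, jimm_K, jimm_U]

theorem jimm_letter (a : Bool) : jimm (letter a) = letter a * genU := by
  cases a <;> simp only [letter, map_mul, jimm_L, jimm_S, mul_assoc]

theorem jimm_twist (d : Bool) : jimm (twist d) = twist d := by
  cases d <;> simp [twist, jimm_U]

theorem mem_graph_jimm (M : PGL(2, ℤ)) : (M, jimm M) ∈ graph := by
  obtain ⟨N, hN⟩ := graph_fst_surjective M
  rwa [jimm_eq_of_mem hN]

theorem jimm_jimm (M : PGL(2, ℤ)) : jimm (jimm M) = M :=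
  jimm_eq_of_mem (graph_swap (mem_graph_jimm M))

theorem FareyEnd.jimm_jimm (b : FareyEnd) : b.jimm.jimm = b := by
  cases b
  simp [FareyEnd.jimm]

theorem decide_odd_succ (n : ℕ) : decide ((n + 1) % 2 = 1) = !decide (n % 2 = 1) := by
  rcases Nat.mod_two_eq_zero_or_one n with h | h <;> simp [h, Nat.add_mod]

theorem decide_odd_add (m n : ℕ) :
    decide ((m + n) % 2 = 1) = xor (decide (m % 2 = 1)) (decide (n % 2 = 1)) := by
  rcases Nat.mod_two_eq_zero_or_one n with h | h <;>
    rcases Nat.mod_two_eq_zero_or_one m with h' | h' <;> simp [h, h', Nat.add_mod]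

/-- Each letter emits a U on its right, and the accumulated twist complements the next letter when
it passes. The twist alternates with `n`; a leading S emits one more U and shifts the phase. -/
theorem FareyEnd.jimm_prefixWord (b : FareyEnd) (n : ℕ) :
    Jimm.jimm (b.prefixWord n) = b.jimm.prefixWord n * twist (xor b.neg (decide (n % 2 = 1))) := by
  induction n with
  | zero => rcases h : b.neg <;> simp [prefixWord, h, FareyEnd.jimm, twist, jimm_S]
  | succ n ih =>
    have hU : genU = twist true := by simp [twist]
    rw [prefixWord, map_mul, ih, jimm_letter, prefixWord, decide_odd_succ, hU, mul_assoc,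
      ← mul_assoc (twist _) (letter _), twist_mul_letter, mul_assoc (letter _), twist_mul_twist,
      ← mul_assoc]
    have e : xor (xor b.neg (decide (n % 2 = 1))) (b.word n) = b.jimm.word n := Bool.xor_comm _ _
    rw [e, Bool.xor_true, Bool.xor_not]

/-! ### Ends related by a group element -/

/-- The group element `g` maps a final segment of the path `b` to a final segment of the path
`b'`, and the initial segment cut from `b'` is longer by `s` letters. -/
def FareyEnd.Rel (g : PGL(2, ℤ)) (s : ℤ) (b b' : FareyEnd) : Prop :=
  ∃ (k l : ℕ) (d : Bool), (k : ℤ) - l = s ∧ g * b.prefixWord l = b'.prefixWord k * twist d ∧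
    ∀ n, b'.word (k + n) = xor d (b.word (l + n))

namespace FareyEnd

theorem mul_prefixWord_add {g : PGL(2, ℤ)} {b b' : FareyEnd} {k l : ℕ} {d : Bool}
    (h : g * b.prefixWord l = b'.prefixWord k * twist d)
    (hw : ∀ n, b'.word (k + n) = xor d (b.word (l + n))) (n : ℕ) :
    g * b.prefixWord (l + n) = b'.prefixWord (k + n) * twist d := by
  induction n with
  | zero => exact h
  | succ n ih =>
    rw [← add_assoc, ← add_assoc, prefixWord, prefixWord, ← mul_assoc, ih, mul_assoc,
      twist_mul_letter, ← hw, mul_assoc]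

variable {g h : PGL(2, ℤ)} {s t : ℤ} {b b' b'' : FareyEnd}

theorem Rel.mul (hh : Rel h t b' b'') (hg : Rel g s b b') : Rel (h * g) (s + t) b b'' := by
  obtain ⟨k, l, d, rfl, e, hw⟩ := hg
  obtain ⟨k', l', d', rfl, e', hw'⟩ := hh
  refine ⟨k' + k, l + l', xor d' d, by push_cast; ring, ?_, fun n => ?_⟩
  · rw [mul_assoc, mul_prefixWord_add e hw, add_comm k l', ← mul_assoc,
      mul_prefixWord_add e' hw', mul_assoc, twist_mul_twist]
  · rw [add_assoc, hw', ← add_assoc, add_comm l' k, add_assoc, hw, add_assoc, Bool.xor_assoc]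

theorem Rel.inv (hg : Rel g s b b') : Rel g⁻¹ (-s) b' b := by
  obtain ⟨k, l, d, rfl, e, hw⟩ := hg
  refine ⟨l, k, d, by ring, ?_, fun n => ?_⟩
  · rw [inv_mul_eq_iff_eq_mul, ← mul_assoc, e, mul_assoc, twist_mul_self, mul_one]
  · rw [hw, ← Bool.xor_assoc, Bool.xor_self, Bool.false_xor]

/-- The twist is harmless because U fixes the base point 1. -/
theorem Rel.represents (hg : Rel g s b b') {x : OnePoint ℝ} (hx : b.Represents x) :
    b'.Represents (g • x) := by
  obtain ⟨k, l, d, -, e, hw⟩ := hg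
  rw [Represents, ← tendsto_add_atTop_iff_nat k]
  have h := tendsto_smul g ((tendsto_add_atTop_iff_nat l).2 hx)
  refine h.congr fun n => ?_
  rw [← mul_smul, add_comm n l, mul_prefixWord_add e hw, mul_smul, twist_smul_one, add_comm]

/-- Both tails are changed by the alternating pattern, so their discrepancy stays constant; the
phases at `k` and `l` only alter the twist. -/
theorem Rel.jimm (hg : Rel g s b b') : Rel (Jimm.jimm g) s b.jimm b'.jimm := by
  obtain ⟨k, l, d, rfl, e, hw⟩ := hg
  refine ⟨k, l, xor (xor (xor b'.neg (decide (k % 2 = 1))) d) (xor b.neg (decide (l % 2 = 1))),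
    rfl, ?_, fun n => ?_⟩
  · have h := congrArg Jimm.jimm e
    rw [map_mul, map_mul, jimm_prefixWord, jimm_prefixWord, jimm_twist, mul_assoc (prefixWord _ _),
      twist_mul_twist, ← mul_assoc, ← eq_mul_inv_iff_mul_eq, twist_inv, mul_assoc,
      twist_mul_twist] at h
    exact h
  · simp only [FareyEnd.jimm, hw, decide_odd_add]
    cases b.word (l + n) <;> cases d <;> cases b.neg <;> cases b'.neg <;>
      cases decide (k % 2 = 1) <;> cases decide (l % 2 = 1) <;> cases decide (n % 2 = 1) <;> rfl

theorem Rel.one (b : FareyEnd) : Rel 1 0 b b :=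
  ⟨0, 0, false, rfl, by simp [twist], fun n => by simp⟩

theorem Rel.conj (hg : Rel g s b b) (hh : Rel h t b b') : Rel (h * g * h⁻¹) s b' b' := by
  have := (hh.mul hg).mul hh.inv
  convert this using 1
  ring

theorem Rel.isOfFinOrder (hg : Rel g 0 b b) : IsOfFinOrder g := by
  obtain ⟨k, l, d, h, e, -⟩ := hg
  obtain rfl : k = l := by omega
  rw [← eq_mul_inv_iff_mul_eq] at e
  rw [isOfFinOrder_iff_pow_eq_one]
  -- With zero shift, `g` is a conjugate of a twist, hence an involution or trivial.
  refine ⟨2, two_pos, ?_⟩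
  rw [e, conj_pow, pow_two, twist_mul_self]
  simp

theorem exists_rel_genU (b : FareyEnd) : ∃ s b', Rel genU s b b' := by
  refine ⟨0, ⟨b.neg, fun n => !b.word n⟩, 0, 0, true, rfl, ?_, fun n => ?_⟩
  · rw [prefixWord_zero_mul_genU]; rfl
  · simp

theorem exists_rel_genS (b : FareyEnd) : ∃ s b', Rel genS s b b' := by
  refine ⟨0, ⟨!b.neg, b.word⟩, 0, 0, false, rfl, ?_, fun n => ?_⟩
  · rcases h : b.neg <;> simp [prefixWord, h, twist, relSS]
  · simp

/-- Three cases: a first letter LS becomes L²S; a first letter L²S becomes L³S = S, losing a letter;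
a leading S becomes the letter LS. -/
theorem exists_rel_genL (b : FareyEnd) : ∃ s b', Rel genL s b b' := by
  obtain ⟨ε, w⟩ := b
  rcases ε with _ | _
  · rcases h0 : w 0 with _ | _
    · refine ⟨0, ⟨false, fun n => if n = 0 then true else w n⟩, 1, 1, false, rfl, ?_, fun n => ?_⟩
      · simp [prefixWord, twist, letter, h0, mul_assoc]
      · simp
    · refine ⟨-1, ⟨true, fun n => w (1 + n)⟩, 0, 1, false, rfl, ?_, fun n => ?_⟩
      · simp [prefixWord, twist, letter, h0, ← mul_assoc, relLLL]
      · simp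
  · refine ⟨1, ⟨false, fun n => if n = 0 then false else w (n - 1)⟩, 1, 0, false, rfl, ?_,
      fun n => ?_⟩
    · simp [prefixWord, twist, letter]
    · simp

theorem exists_rel (g : PGL(2, ℤ)) (b : FareyEnd) : ∃ s b', Rel g s b b' := by
  have mul : ∀ g h : PGL(2, ℤ), (∀ b, ∃ s b', Rel g s b b') → (∀ b, ∃ s b', Rel h s b b') →
      ∀ b, ∃ s b', Rel (g * h) s b b' := by
    intro g h hg hh b
    obtain ⟨s, b', hb'⟩ := hh b
    obtain ⟨t, b'', hb''⟩ := hg b'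
    exact ⟨_, _, hb''.mul hb'⟩
  have hV : ∀ b, ∃ s b', Rel genV s b b' := by
    have e : genV = genU * genS := by rw [← relUV, ← mul_assoc, relUU, one_mul]
    rw [e]
    exact mul _ _ exists_rel_genU exists_rel_genS
  have hK : ∀ b, ∃ s b', Rel genK s b b' := by
    have e : genK = genL * genU := by rw [← relKU, mul_assoc, relUU, mul_one]
    rw [e]
    exact mul _ _ exists_rel_genL exists_rel_genU
  have hg : g ∈ Subgroup.closure {genU, genV, genK} := closure_UVK ▸ Subgroup.mem_top g
  induction hg using Subgroup.closure_induction_left generalizing b with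
  | one => exact ⟨0, b, Rel.one b⟩
  | mul_left x hx y _ ih =>
    rcases hx with rfl | rfl | rfl
    exacts [mul _ _ exists_rel_genU ih b, mul _ _ hV ih b, mul _ _ hK ih b]
  | inv_mul_cancel x hx y _ ih =>
    rcases hx with rfl | rfl | rfl
    · rw [genU_inv]; exact mul _ _ exists_rel_genU ih b
    · rw [inv_eq_of_mul_eq_one_left relVV]; exact mul _ _ hV ih b
    · rw [inv_eq_of_mul_eq_one_left relKK]; exact mul _ _ hK ih b

/-- The word of `b` is constant from some point on. -/
def EventuallyConst (b : FareyEnd) : Prop := ∃ (k : ℕ) (a : Bool), ∀ n, b.word (k + n) = a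

theorem Rel.eventuallyConst (hg : Rel g s b b') (hb : b.EventuallyConst) :
    b'.EventuallyConst := by
  obtain ⟨k, l, d, -, -, hw⟩ := hg
  obtain ⟨m, a, ha⟩ := hb
  refine ⟨k + m, xor d a, fun n => ?_⟩
  rw [add_assoc, hw, ← ha (l + n)]
  congr 2
  ring

theorem Represents.eventuallyConst {x : OnePoint ℝ} (hb : b.Represents x) (hx : IsRat x) :
    b.EventuallyConst := by
  obtain ⟨g, rfl⟩ := hx
  obtain ⟨s, b', hb'⟩ := exists_rel g⁻¹ b
  have h := hb'.represents hb
  rw [inv_smul_smul] at h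
  refine hb'.inv.eventuallyConst ?_
  rcases h.eq_of_infty with rfl | rfl
  exacts [⟨0, false, fun _ => rfl⟩, ⟨0, true, fun _ => rfl⟩]

theorem EventuallyConst.not_jimm (hb : b.EventuallyConst) : ¬ b.jimm.EventuallyConst := by
  rintro ⟨l, a', h'⟩
  obtain ⟨k, a, h⟩ := hb
  have h1 := h' k
  have h2 := h' (k + 1)
  simp only [FareyEnd.jimm] at h1 h2
  rw [show l + k = k + l by ring, h] at h1
  rw [show l + (k + 1) = k + (l + 1) by ring, h, ← add_assoc, decide_odd_succ, ← h1] at h2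
  revert h2
  cases a <;> cases b.neg <;> cases decide ((k + l) % 2 = 1) <;> decide

/-- With zero shift, the tails of `b` and `b.jimm` at the same positions would differ by a constant,
whereas they differ by an alternating word. -/
theorem Rel.shift_ne_zero (hb : Rel g s b b.jimm) : s ≠ 0 := by
  rintro rfl
  obtain ⟨k, l, d, h, -, hw⟩ := hb
  obtain rfl : k = l := by omega
  have h0 := hw 0
  have h1 := hw 1
  simp only [FareyEnd.jimm, add_zero, decide_odd_succ] at h0 h1
  revert h0 h1
  cases b.word k <;> cases b.word (k + 1) <;> cases b.neg <;> cases d <;>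
    cases decide (k % 2 = 1) <;> decide

end FareyEnd

/-! ### Attracting fixed points -/

/-- All but finitely many points are attracted to `p` by the powers of `g`. -/
def IsAttracting (g : PGL(2, ℤ)) (p : OnePoint ℝ) : Prop :=
  ∀ᶠ q : OnePoint ℝ in cofinite, Tendsto (fun n : ℕ => g ^ n • q) atTop (𝓝 p)

instance : Infinite (OnePoint ℝ) := Infinite.of_injective _ OnePoint.coe_injective

theorem IsAttracting.unique {g : PGL(2, ℤ)} {p p' : OnePoint ℝ} (h : IsAttracting g p)
    (h' : IsAttracting g p') : p = p' := by
  obtain ⟨q, hq, hq'⟩ := (h.and h').exists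
  exact tendsto_nhds_unique hq hq'

theorem IsAttracting.smul_eq {g : PGL(2, ℤ)} {p : OnePoint ℝ} (h : IsAttracting g p) :
    g • p = p := by
  obtain ⟨q, hq⟩ := h.exists
  refine tendsto_nhds_unique (tendsto_smul g hq) ?_
  simpa only [← mul_smul, ← pow_succ'] using (tendsto_add_atTop_iff_nat 1).2 hq

theorem IsAttracting.not_isOfFinOrder {g : PGL(2, ℤ)} {p : OnePoint ℝ} (h : IsAttracting g p) :
    ¬ IsOfFinOrder g := by
  rw [isOfFinOrder_iff_pow_eq_one]
  rintro ⟨k, hk, hg⟩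
  have hp : ∀ᶠ q : OnePoint ℝ in cofinite, q ≠ p := by
    rw [eventually_cofinite]
    simp
  obtain ⟨q, hq, hqp⟩ := (h.and hp).exists
  refine hqp (tendsto_nhds_unique tendsto_const_nhds
    ((hq.comp (tendsto_id.const_mul_atTop' hk)).congr fun n => ?_))
  simp [pow_mul, hg]

theorem eventually_cofinite_smul {P : OnePoint ℝ → Prop} (h : ∀ᶠ q in cofinite, P q)
    (g : PGL(2, ℤ)) : ∀ᶠ q in cofinite, P (g • q) :=
  (MulAction.injective g).tendsto_cofinite.eventually h

theorem IsAttracting.conj {g : PGL(2, ℤ)} {p : OnePoint ℝ} (hp : IsAttracting g p)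
    (h : PGL(2, ℤ)) : IsAttracting (h * g * h⁻¹) (h • p) := by
  filter_upwards [eventually_cofinite_smul hp h⁻¹] with q hq
  refine (tendsto_smul h hq).congr fun n => ?_
  rw [conj_pow, mul_smul, mul_smul]

theorem IsPositive.exists_tendsto {g : PGL(2, ℤ)} (hg : IsPositive g) :
    ∃ p : OnePoint ℝ, Tendsto (fun x : ℕ × OnePoint ℝ => g ^ x.1 • x.2)
      (atTop ×ˢ 𝓟 cone) (𝓝 p) := by
  simpa only [partialProd_const] using exists_tendsto_partialProd fun _ => hg

theorem tendsto_pow_smul_of_mem_cone {g : PGL(2, ℤ)} {p : OnePoint ℝ}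
    (h : Tendsto (fun x : ℕ × OnePoint ℝ => g ^ x.1 • x.2) (atTop ×ˢ 𝓟 cone) (𝓝 p))
    {f : ℕ → OnePoint ℝ} (hf : ∀ n, f n ∈ cone) :
    Tendsto (fun n : ℕ => g ^ n • f n) atTop (𝓝 p) := by
  have := h.comp (tendsto_id.prodMk (tendsto_principal.2 (Eventually.of_forall hf)))
  exact this

theorem IsPositive.isAttracting {g : PGL(2, ℤ)} (hg : IsPositive g) {p : OnePoint ℝ}
    (h : Tendsto (fun x : ℕ × OnePoint ℝ => g ^ x.1 • x.2) (atTop ×ˢ 𝓟 cone) (𝓝 p)) :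
    IsAttracting g p := by
  obtain ⟨p', hp'⟩ := hg.genV_conj_inv.exists_tendsto
  rw [IsAttracting, eventually_cofinite]
  refine (Set.finite_singleton (genV⁻¹ • p')).subset fun q hq => ?_
  -- An orbit that enters the cone converges to `p`, so an exceptional `q` never enters it.
  have hout : ∀ n : ℕ, g ^ n • q ∉ cone := by
    intro n hn
    refine hq ((tendsto_add_atTop_iff_nat n).1 ?_)
    simpa only [pow_add, mul_smul] using tendsto_pow_smul_of_mem_cone h fun _ => hn
  have hlim := tendsto_pow_smul_of_mem_cone hp' (f := fun n => genV • g ^ n • q)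
    fun n => genV_smul_mem_cone (hout n)
  -- Going forward under `g` and back under its positive conjugate gives a constant sequence, which
  -- must equal the limit `p'`; this leaves a single exceptional point.
  have hconst : ∀ n : ℕ, (genV * g⁻¹ * genV) ^ n • genV • g ^ n • q = genV • q := by
    intro n
    have e : (genV * g⁻¹ * genV) ^ n = genV * (g ^ n)⁻¹ * genV := by
      have := conj_pow (i := n) (a := genV) (b := g⁻¹)
      rwa [inv_eq_of_mul_eq_one_left relVV, inv_pow] at this
    rw [e]
    simp only [← mul_smul]
    rw [mul_assoc (_ * _) genV, ← mul_assoc genV genV, relVV, one_mul, inv_mul_cancel_right]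
  simp only [hconst] at hlim
  rw [Set.mem_singleton_iff, eq_inv_smul_iff]
  exact tendsto_nhds_unique tendsto_const_nhds hlim

theorem isPositive_partialProd {e : ℕ → PGL(2, ℤ)} (he : ∀ n, IsPositive (e n)) (n : ℕ) :
    IsPositive (partialProd e (n + 1)) := by
  induction n with
  | zero => simpa [partialProd] using he 0
  | succ n ih => rw [partialProd]; exact ih.mul (he _)

theorem IsPositive.mul_twist {g : PGL(2, ℤ)} (hg : IsPositive g) (d : Bool) :
    IsPositive (g * twist d) := by
  cases d
  · simpa [twist] using hg
  · simpa [twist] using hg.mul_genU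

theorem FareyEnd.Rel.isAttracting {g : PGL(2, ℤ)} {s : ℤ} {c : FareyEnd} (hg : Rel g s c c)
    (hs : 0 < s) {p : OnePoint ℝ} (hp : c.Represents p) : IsAttracting g p := by
  obtain ⟨k, l, d, rfl, e, hw⟩ := hg
  obtain ⟨m, rfl⟩ : ∃ m, k = l + (m + 1) := ⟨k - l - 1, by omega⟩
  set h := c.prefixWord l with hh
  -- Conjugating by the initial word turns `g` into a nonempty product of letters times a twist,
  -- which is positive.
  set G := h⁻¹ * g * h with hG
  have hG' : G = partialProd (fun i => letter (c.word (l + i))) (m + 1) * twist d := by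
    rw [hG, mul_assoc, e, prefixWord_add, ← hh]
    group
  have hpos : IsPositive G := by
    rw [hG']
    exact (isPositive_partialProd (fun _ => isPositive_letter _) m).mul_twist d
  have key : ∀ n : ℕ, ∃ a, g ^ n * c.prefixWord l = c.prefixWord (l + n * (m + 1)) * twist a ∧
      ∀ i, c.word (l + n * (m + 1) + i) = xor a (c.word (l + i)) := by
    intro n
    induction n with
    | zero => exact ⟨false, by simp [twist], fun i => by simp⟩
    | succ n ih =>
      obtain ⟨a, ha, ha'⟩ := ih
      refine ⟨xor a d, ?_, fun i => ?_⟩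
      · rw [pow_succ, mul_assoc, e, ← mul_assoc, mul_prefixWord_add ha ha', mul_assoc,
          twist_mul_twist, add_assoc, Nat.succ_mul]
      · rw [Nat.succ_mul, ← add_assoc, add_assoc, ha', ← add_assoc, hw, Bool.xor_assoc]
  obtain ⟨p0, hp0⟩ := hpos.exists_tendsto
  have h1 : IsAttracting g (h • p0) := by
    have := (hpos.isAttracting hp0).conj h
    rwa [hG, show h * (h⁻¹ * g * h) * h⁻¹ = g by group] at this
  suffices p = h • p0 by rwa [this]
  have h2 := tendsto_smul h (tendsto_pow_smul_of_mem_cone hp0 fun _ => one_mem_cone)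
  have h3 : Tendsto (fun n : ℕ => l + n * (m + 1)) atTop atTop :=
    tendsto_atTop_mono (fun n => by simp only [id_eq]; nlinarith) tendsto_id
  refine tendsto_nhds_unique (hp.comp h3) (h2.congr fun n => ?_)
  obtain ⟨a, ha, -⟩ := key n
  have e' : h * G ^ n = g ^ n * h := by
    have := conj_pow (i := n) (a := h⁻¹) (b := g)
    rw [inv_inv] at this
    rw [hG, this]
    group
  rw [← mul_smul, e', ha, mul_smul, twist_smul_one]
  rfl

theorem FareyEnd.Rel.not_isOfFinOrder {g : PGL(2, ℤ)} {s : ℤ} {c : FareyEnd} (hg : Rel g s c c)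
    (hs : s ≠ 0) : ¬ IsOfFinOrder g := by
  obtain ⟨p, hp⟩ := c.exists_represents
  rcases hs.lt_or_gt with h | h
  · rw [← isOfFinOrder_inv_iff]
    exact (hg.inv.isAttracting (by omega) hp).not_isOfFinOrder
  · exact (hg.isAttracting h hp).not_isOfFinOrder

/-! ### The induced map -/

theorem cls_eq_iff {x y : OnePoint ℝ} : cls x = cls y ↔ ∃ g : PGL(2, ℤ), g • y = x := by
  rw [cls, cls, Quotient.eq, MulAction.orbitRel_apply, MulAction.mem_orbit_iff]

theorem cls_smul (g : PGL(2, ℤ)) (x : OnePoint ℝ) : cls (g • x) = cls x :=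
  cls_eq_iff.2 ⟨g, rfl⟩

theorem exists_isJimmValue (x : OnePoint ℝ) : ∃ y, IsJimmValue x y := by
  obtain ⟨b, hb⟩ := exists_end x
  obtain ⟨y, hy⟩ := b.jimm.exists_represents
  exact ⟨y, b, hb, hy⟩

theorem IsJimmValue.symm {x y : OnePoint ℝ} (h : IsJimmValue x y) : IsJimmValue y x := by
  obtain ⟨b, hx, hy⟩ := h
  exact ⟨b.jimm, hy, by rwa [b.jimm_jimm]⟩

theorem IsJimmValue.smul {x y : OnePoint ℝ} (h : IsJimmValue x y) (g : PGL(2, ℤ)) :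
    IsJimmValue (g • x) (jimm g • y) := by
  obtain ⟨b, hx, hy⟩ := h
  obtain ⟨s, b', hb'⟩ := FareyEnd.exists_rel g b
  exact ⟨b', hb'.represents hx, hb'.jimm.represents hy⟩

theorem jimm_endInfty' : endInfty'.jimm = ⟨true, endInfty.jimm.word⟩ := by
  simp [endInfty', endInfty, FareyEnd.jimm]

/-- The opposite letters of the two ends cancel against the opposite phases, so the jimm images have
equal words and differ only in the leading S. -/
theorem endInfty_jimm_represents {y : OnePoint ℝ} :
    endInfty'.jimm.Represents y ↔ endInfty.jimm.Represents (genS • y) := by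
  rw [jimm_endInfty', FareyEnd.represents_iff, FareyEnd.represents_iff]
  simp [FareyEnd.prefixWord, FareyEnd.jimm, endInfty, genS_inv]

theorem IsJimmValue.cls_eq_of_infty {y y' : OnePoint ℝ} (h : IsJimmValue ∞ y)
    (h' : IsJimmValue ∞ y') : cls y = cls y' := by
  have key : ∀ {y}, IsJimmValue ∞ y → ∃ z, endInfty.jimm.Represents z ∧ cls y = cls z := by
    rintro y ⟨b, hb, hy⟩
    rcases hb.eq_of_infty with rfl | rfl
    · exact ⟨y, hy, rfl⟩
    · exact ⟨_, endInfty_jimm_represents.1 hy, (cls_smul _ _).symm⟩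
  obtain ⟨z, hz, e⟩ := key h
  obtain ⟨z', hz', e'⟩ := key h'
  rw [e, e', hz.unique hz']

/-- Equivariance reduces to `x = x'`. An irrational has a single end, and a rational is moved to
`∞`. -/
theorem IsJimmValue.cls_eq {x x' y y' : OnePoint ℝ} (h : IsJimmValue x y)
    (h' : IsJimmValue x' y') (hx : cls x = cls x') : cls y = cls y' := by
  obtain ⟨g, rfl⟩ := cls_eq_iff.1 hx
  have h1 := h'.smul g
  rw [← cls_smul (jimm g) y']
  generalize jimm g • y' = z at h1
  generalize g • x' = x at h h1
  by_cases hr : IsRat x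
  · obtain ⟨k, rfl⟩ := hr
    have h2 := h.smul k⁻¹
    have h3 := h1.smul k⁻¹
    rw [inv_smul_smul] at h2 h3
    simpa only [cls_smul] using h2.cls_eq_of_infty h3
  · obtain ⟨b, hb, hy⟩ := h
    obtain ⟨b', hb', hz⟩ := h1
    obtain rfl := hb.end_unique hb' hr
    rw [hy.unique hz]

theorem existsUnique_isInducedByJimm : ∃! ι : Moduli → Moduli, IsInducedByJimm ι := by
  choose f hf using exists_isJimmValue
  have hcls : ∀ q : Moduli, ∃ x, cls x = q := fun q => Quotient.exists_rep q
  choose r hr using hcls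
  refine ⟨fun q => cls (f (r q)), fun x y h => (hf _).cls_eq h (hr _), fun κ hκ => ?_⟩
  funext q
  rw [← hκ _ _ (hf (r q)), hr]

theorem IsInducedByJimm.involutive {ι : Moduli → Moduli} (hι : IsInducedByJimm ι) :
    Function.Involutive ι := by
  intro q
  obtain ⟨x, rfl⟩ : ∃ x, cls x = q := Quotient.exists_rep q
  obtain ⟨y, h⟩ := exists_isJimmValue x
  rw [hι x y h, hι y x h.symm]

/-! ### Fixed points -/

theorem IsRat.of_cls_eq {x y : OnePoint ℝ} (hx : IsRat x) (h : cls y = cls x) : IsRat y := by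
  obtain ⟨g, rfl⟩ := cls_eq_iff.1 h
  exact hx.smul g

theorem IsInducedByJimm.not_isRat {ι : Moduli → Moduli} (hι : IsInducedByJimm ι) {x : OnePoint ℝ}
    (h : ι (cls x) = cls x) : ¬ IsRat x := by
  intro hx
  obtain ⟨y, b, hb, hy⟩ := exists_isJimmValue x
  rw [hι x y ⟨b, hb, hy⟩] at h
  exact (hb.eventuallyConst hx).not_jimm (hy.eventuallyConst (hx.of_cls_eq h))

theorem IsInducedByJimm.exists_smul_eq {ι : Moduli → Moduli} (hι : IsInducedByJimm ι)
    {x : OnePoint ℝ} (h : ι (cls x) = cls x) :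
    ∃ M : PGL(2, ℤ), ¬ IsOfFinOrder (jimm M * M) ∧ (jimm M * M) • x = x := by
  have hr := hι.not_isRat h
  obtain ⟨y, b, hb, hy⟩ := exists_isJimmValue x
  rw [hι x y ⟨b, hb, hy⟩] at h
  obtain ⟨M, rfl⟩ := cls_eq_iff.1 h
  obtain ⟨s, b', hM⟩ := FareyEnd.exists_rel M b
  obtain rfl := (hM.represents hb).end_unique hy ((isRat_smul_iff M).not.2 hr)
  have hj := hM.jimm
  rw [b.jimm_jimm] at hj
  have hjM := hj.mul hM
  have hs := hM.shift_ne_zero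
  exact ⟨M, hjM.not_isOfFinOrder (by omega), (hjM.represents hb).unique hb⟩

/-- Some power of an element fixing a point fixes an end of that point. -/
theorem exists_pow_rel {g : PGL(2, ℤ)} {x : OnePoint ℝ} (hx : g • x = x) :
    ∃ i : ℕ, 0 < i ∧ ∃ s b, b.Represents x ∧ FareyEnd.Rel (g ^ i) s b b := by
  by_cases hr : IsRat x
  · obtain ⟨h, rfl⟩ := hr
    have hfix : (h⁻¹ * g * h) • (∞ : OnePoint ℝ) = ∞ := by
      rw [mul_smul, mul_smul, hx, inv_smul_smul]
    have key : ∃ i : ℕ, 0 < i ∧ ∃ s b, b.Represents ∞ ∧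
        FareyEnd.Rel ((h⁻¹ * g * h) ^ i) s b b := by
      have hstep : ∀ b : FareyEnd, b.Represents ∞ → ∃ s b', b'.Represents ∞ ∧
          FareyEnd.Rel (h⁻¹ * g * h) s b b' := by
        intro b hb
        obtain ⟨s, b', hb'⟩ := FareyEnd.exists_rel (h⁻¹ * g * h) b
        exact ⟨s, b', by simpa only [hfix] using hb'.represents hb, hb'⟩
      obtain ⟨b0, hb0⟩ := exists_end ∞
      obtain ⟨s1, b1, hb1, r1⟩ := hstep b0 hb0
      obtain ⟨s2, b2, hb2, r2⟩ := hstep b1 hb1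
      -- `∞` has only two ends, so two of three successive images coincide.
      have h3 : b0 = b1 ∨ b1 = b2 ∨ b0 = b2 := by
        rcases hb0.eq_of_infty with rfl | rfl <;> rcases hb1.eq_of_infty with rfl | rfl <;>
          rcases hb2.eq_of_infty with rfl | rfl <;> simp
      rcases h3 with rfl | rfl | rfl
      · exact ⟨1, one_pos, s1, b0, hb0, by rwa [pow_one]⟩
      · exact ⟨1, one_pos, s2, b1, hb1, by rwa [pow_one]⟩
      · exact ⟨2, two_pos, _, b0, hb0, by rw [pow_two]; exact r2.mul r1⟩
    obtain ⟨i, hi, s, b, hb, r⟩ := key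
    obtain ⟨t, b', hb'⟩ := FareyEnd.exists_rel h b
    refine ⟨i, hi, s, b', hb'.represents hb, ?_⟩
    have := r.conj hb'
    rwa [← conj_pow, show h * (h⁻¹ * g * h) * h⁻¹ = g by group] at this
  · obtain ⟨b, hb⟩ := exists_end x
    obtain ⟨s, b', hb'⟩ := FareyEnd.exists_rel g b
    have h := hb'.represents hb
    rw [hx] at h
    obtain rfl := hb.end_unique h hr
    exact ⟨1, one_pos, s, b, hb, by rwa [pow_one]⟩

theorem FareyEnd.Rel.unique {g : PGL(2, ℤ)} {s : ℤ} {b b' : FareyEnd} (h : Rel g s b b)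
    (h' : Rel g s b' b') (hs : s ≠ 0) {x x' : OnePoint ℝ} (hx : b.Represents x)
    (hx' : b'.Represents x') : x = x' := by
  rcases hs.lt_or_gt with hs | hs
  · exact (h.inv.isAttracting (by omega) hx).unique (h'.inv.isAttracting (by omega) hx')
  · exact (h.isAttracting hs hx).unique (h'.isAttracting hs hx')

theorem IsInducedByJimm.eq_of_smul_eq {ι : Moduli → Moduli} (hι : IsInducedByJimm ι)
    {x : OnePoint ℝ} {M : PGL(2, ℤ)} (hM : ¬ IsOfFinOrder (jimm M * M))
    (hx : (jimm M * M) • x = x) : ι (cls x) = cls x := by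
  obtain ⟨i, hi, s, b, hb, r⟩ := exists_pow_rel hx
  have hs : s ≠ 0 := by
    rintro rfl
    exact hM (IsOfFinOrder.of_pow r.isOfFinOrder hi.ne')
  obtain ⟨y, hy⟩ := b.jimm.exists_represents
  obtain ⟨t, b', hb'⟩ := FareyEnd.exists_rel M b
  have h1 := r.jimm
  have h2 := r.conj hb'
  -- So one element preserves both `b.jimm` and `b'` with shift `s`, and these ends represent the
  -- same point.
  have e : jimm ((jimm M * M) ^ i) = M * (jimm M * M) ^ i * M⁻¹ := by
    rw [← conj_pow, map_pow, map_mul, jimm_jimm]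
    congr 1
    group
  rw [e] at h1
  rw [hι x y ⟨b, hb, hy⟩, h1.unique h2 hs hy (hb'.represents hb), cls_smul]

/-! ### Alternating words -/

theorem altProd_two_mul (M : PGL(2, ℤ)) (n : ℕ) : altProd M (2 * n) = (jimm M * M) ^ n := by
  induction n with
  | zero => rw [mul_zero, altProd, pow_zero]
  | succ n ih =>
    rw [mul_add, altProd, altProd, ih, if_pos (even_two_mul n), if_neg (by simp),
      pow_succ, mul_assoc]

theorem altProd_two_mul_add_one (M : PGL(2, ℤ)) (n : ℕ) :
    altProd M (2 * n + 1) = (jimm M * M) ^ n * jimm M := by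
  rw [altProd, altProd_two_mul, if_pos (even_two_mul n)]

/-- Even partial products are powers of `jimm M * M`; odd ones are such powers applied after `jimm
M`, which preserves cofiniteness. -/
theorem isAltWordPoint_iff {M : PGL(2, ℤ)} {x : OnePoint ℝ} :
    IsAltWordPoint M x ↔ IsAttracting (jimm M * M) x := by
  constructor
  · intro h
    filter_upwards [h] with q hq
    refine (hq.comp (tendsto_id.const_mul_atTop' two_pos)).congr fun n => ?_
    simp [altProd_two_mul]
  · intro h
    filter_upwards [h, eventually_cofinite_smul h (jimm M)] with q hq hq'
    have h0 : Tendsto (fun n => altProd M (2 * n) • q) atTop (𝓝 x) := by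
      simpa only [altProd_two_mul] using hq
    have h1 : Tendsto (fun n => altProd M (2 * n + 1) • q) atTop (𝓝 x) := by
      simpa only [altProd_two_mul_add_one, mul_smul] using hq'
    rw [tendsto_def] at h0 h1 ⊢
    intro s hs
    have h0' := h0 s hs
    have h1' := h1 s hs
    rw [mem_atTop_sets] at h0' h1' ⊢
    obtain ⟨a, ha⟩ := h0'
    obtain ⟨c, hc⟩ := h1'
    refine ⟨2 * a + 2 * c, fun n hn => ?_⟩
    obtain ⟨k, rfl | rfl⟩ := n.even_or_odd'
    · exact ha k (by omega)
    · exact hc k (by omega)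

theorem IsInducedByJimm.exists_isAltWordPoint {ι : Moduli → Moduli} (hι : IsInducedByJimm ι)
    {x : OnePoint ℝ} (h : ι (cls x) = cls x) : ∃ M : PGL(2, ℤ), IsAltWordPoint M x := by
  obtain ⟨M, hM, hx⟩ := hι.exists_smul_eq h
  obtain ⟨b, hb⟩ := exists_end x
  obtain ⟨s, b', hb'⟩ := FareyEnd.exists_rel (jimm M * M) b
  have h1 := hb'.represents hb
  rw [hx] at h1
  obtain rfl := hb.end_unique h1 (hι.not_isRat h)
  have hs : s ≠ 0 := by
    rintro rfl
    exact hM hb'.isOfFinOrder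
  rcases hs.lt_or_gt with hs | hs
  -- For this element the product is `(jimm M * M)⁻¹`, which reverses the sign of the shift.
  · refine ⟨(jimm M)⁻¹, isAltWordPoint_iff.2 ?_⟩
    rw [map_inv, jimm_jimm, ← mul_inv_rev]
    exact hb'.inv.isAttracting (by omega) hb
  · exact ⟨M, isAltWordPoint_iff.2 (hb'.isAttracting hs hb)⟩

theorem IsInducedByJimm.eq_of_isAltWordPoint {ι : Moduli → Moduli} (hι : IsInducedByJimm ι)
    {x : OnePoint ℝ} {M : PGL(2, ℤ)} (h : IsAltWordPoint M x) : ι (cls x) = cls x := by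
  rw [isAltWordPoint_iff] at h
  exact hι.eq_of_smul_eq h.not_isOfFinOrder h.smul_eq

/-! ### Continued fractions -/

theorem genT_pow_smul_coe (n : ℕ) (x : ℝ) :
    genT ^ n • (x : OnePoint ℝ) = ((n + x : ℝ) : OnePoint ℝ) := by
  induction n with
  | zero => simp
  | succ n ih =>
    rw [pow_succ', mul_smul, ih, genT_smul_coe]
    congr 1
    push_cast
    ring

theorem contFrac_convs'_zero (d : ℕ → ℕ) : (contFrac d).convs' 0 = d 0 := by
  simp [contFrac]

theorem contFrac_convs'_succ (d : ℕ → ℕ) (n : ℕ) :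
    (contFrac d).convs' (n + 1) = d 0 + ((contFrac fun i => d (i + 1)).convs' n)⁻¹ := by
  rw [GenContFract.convs', GenContFract.convs'Aux_succ_some (p := ⟨1, (d 1 : ℝ)⟩) rfl, one_div]
  rfl

/-- `genT ^ d * genU` is `x ↦ d + 1/x`. The convergent of index `n` uses `n + 1` factors, the last
of which sends `∞` to its digit. -/
theorem partialProd_smul_infty {d : ℕ → ℕ} (hd : ∀ i, 1 ≤ d i) (n : ℕ) :
    0 < (contFrac d).convs' n ∧ partialProd (fun i => genT ^ d i * genU) (n + 1) • ∞ =
      (((contFrac d).convs' n : ℝ) : OnePoint ℝ) := by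
  induction n generalizing d with
  | zero =>
    have h : (0 : ℝ) < d 0 := by exact_mod_cast hd 0
    refine ⟨by rwa [contFrac_convs'_zero], ?_⟩
    rw [contFrac_convs'_zero, partialProd, partialProd, one_mul, mul_smul, genU_smul_infty,
      genT_pow_smul_coe, add_zero]
  | succ n ih =>
    obtain ⟨h0, h⟩ := ih fun i => hd (i + 1)
    have h' : (0 : ℝ) < d 0 := by exact_mod_cast hd 0
    refine ⟨by rw [contFrac_convs'_succ]; positivity, ?_⟩
    rw [contFrac_convs'_succ, show n + 1 + 1 = 1 + (n + 1) by ring, partialProd_add, mul_smul]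
    simp only [add_comm 1]
    rw [h, partialProd, partialProd, one_mul, mul_smul, genU_smul_coe, if_neg h0.ne',
      genT_pow_smul_coe]

theorem contFrac_convs {d : ℕ → ℕ} (hd : ∀ i, 1 ≤ d i) (n : ℕ) :
    (contFrac d).convs n = (contFrac d).convs' n := by
  refine GenContFract.convs_eq_convs' fun {gp m} _ h => ?_
  obtain rfl : ⟨1, (d (m + 1) : ℝ)⟩ = gp := Option.some.inj h
  exact ⟨one_pos, Nat.cast_pos.2 (hd (m + 1))⟩

theorem isPositive_genT_pow_mul_genU {n : ℕ} (hn : 1 ≤ n) : IsPositive (genT ^ n * genU) := by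
  refine IsPositive.mul_genU ?_
  induction n, hn using Nat.le_induction with
  | base => rw [pow_one]; exact isPositive_genT
  | succ n _ ih => rw [pow_succ]; exact ih.mul isPositive_genT

theorem partialProd_congr {e e' : ℕ → PGL(2, ℤ)} {n : ℕ} (h : ∀ i < n, e i = e' i) :
    partialProd e n = partialProd e' n := by
  induction n with
  | zero => rfl
  | succ n ih =>
    rw [partialProd, partialProd, ih fun i hi => h i (by omega), h n (by omega)]

theorem partialProd_mul_of_periodic {e : ℕ → PGL(2, ℤ)} {m : ℕ} (he : ∀ i, e (m + i) = e i)
    (n : ℕ) : partialProd e (m * n) = partialProd e m ^ n := by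
  induction n with
  | zero => rw [mul_zero, partialProd, pow_zero]
  | succ n ih => rw [mul_add, mul_one, add_comm, partialProd_add, funext he, ih, pow_succ']

theorem one_le_onesDigits (k i : ℕ) : 1 ≤ onesDigits k i := by
  rw [onesDigits]
  split_ifs <;> omega

theorem partialProd_onesDigits (k : ℕ) :
    partialProd (fun i => genT ^ onesDigits k i * genU) (k + 1) =
      (genT * genU) ^ k * (genT ^ (k + 2) * genU) := by
  have h : ∀ i < k, genT ^ onesDigits k i * genU = genT * genU := fun i hi => by
    rw [onesDigits, if_neg (by rw [Nat.mod_eq_of_lt (by omega)]; omega), pow_one]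
  rw [partialProd, partialProd_congr h, partialProd_const, onesDigits,
    if_pos (Nat.mod_eq_of_lt (by omega))]

theorem jimm_genT : jimm genT = genT * genU := by
  rw [← letter_false, jimm_letter]

/-- The left side is (TU)^(k+1) T^(k+1). Rotating this word cyclically gives (TU)^k T^(k+2) U, the
period of the continued fraction. -/
theorem jimm_genT_pow_mul (k : ℕ) :
    jimm (genT ^ (k + 1)) * genT ^ (k + 1) =
      ((genT * genU) ^ k * genT ^ (k + 1))⁻¹ * ((genT * genU) ^ k * (genT ^ (k + 2) * genU)) *
        ((genT * genU) ^ k * genT ^ (k + 1)) := by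
  rw [map_pow, jimm_genT, mul_assoc _⁻¹, eq_inv_mul_iff_mul_eq]
  rw [pow_succ' (genT * genU) k, pow_succ genT (k + 1)]
  simp only [mul_assoc]

theorem IsInducedByJimm.onesDigits {ι : Moduli → Moduli} (hι : IsInducedByJimm ι) (k : ℕ) :
    ∃ z : ℝ, Tendsto (contFrac (onesDigits k)).convs atTop (𝓝 z) ∧ ι (cls z) = cls z ∧
      ∃ x : OnePoint ℝ, IsAltWordPoint (genT ^ (k + 1)) x ∧ cls x = cls z := by
  set e : ℕ → PGL(2, ℤ) := fun i => genT ^ Jimm.onesDigits k i * genU with he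
  have hpos : ∀ i, IsPositive (e i) := fun i =>
    isPositive_genT_pow_mul_genU (one_le_onesDigits k i)
  have hper : ∀ i, e (k + 1 + i) = e i := fun i => by simp [he, Jimm.onesDigits]
  set D := partialProd e (k + 1) with hD
  have hDpos : IsPositive D := isPositive_partialProd hpos k
  set h := (genT * genU) ^ k * genT ^ (k + 1) with hh
  obtain ⟨p, hp⟩ := exists_tendsto_partialProd hpos
  obtain ⟨p', hp'⟩ := hDpos.exists_tendsto
  have hlim := tendsto_of_tendsto_cone hp fun _ => infty_mem_cone
  -- Powers of the period `D` are the partial products at multiples of `k + 1`.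
  obtain rfl : p' = p := by
    refine tendsto_nhds_unique (tendsto_pow_smul_of_mem_cone hp' fun _ => infty_mem_cone)
      ((hlim.comp (tendsto_id.const_mul_atTop' k.succ_pos)).congr fun n => ?_)
    rw [← partialProd_mul_of_periodic hper]
    rfl
  have halt : IsAltWordPoint (genT ^ (k + 1)) (h⁻¹ • p') := by
    have := (hDpos.isAttracting hp').conj h⁻¹
    rwa [inv_inv, hD, he, partialProd_onesDigits, hh, ← jimm_genT_pow_mul,
      ← isAltWordPoint_iff] at this
  have hfix : ι (cls p') = cls p' := by
    simpa only [cls_smul] using hι.eq_of_isAltWordPoint halt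
  -- The limit is finite because a fixed class contains no rational point.
  obtain ⟨z, rfl⟩ : ∃ z : ℝ, (z : OnePoint ℝ) = p' := by
    rw [← OnePoint.ne_infty_iff_exists]
    rintro rfl
    exact hι.not_isRat hfix isRat_infty
  refine ⟨z, ?_, hfix, _, halt, cls_smul _ _⟩
  have hconv : Tendsto (fun n => (((contFrac (Jimm.onesDigits k)).convs' n : ℝ) : OnePoint ℝ))
      atTop (𝓝 (z : OnePoint ℝ)) := by
    refine ((tendsto_add_atTop_iff_nat 1).2 hlim).congr fun n => ?_
    exact (partialProd_smul_infty (one_le_onesDigits k) n).2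
  exact (OnePoint.isOpenEmbedding_coe.tendsto_nhds_iff.2 hconv).congr fun n =>
    (contFrac_convs (one_le_onesDigits k) n).symm

end Jimm

/-- The involution induced by `jimm` on the moduli space of real lattices, and its fixed points. -/
theorem mainTheorem8 :
    (∃! ι : Jimm.Moduli → Jimm.Moduli, Jimm.IsInducedByJimm ι) ∧
    ∀ ι : Jimm.Moduli → Jimm.Moduli, Jimm.IsInducedByJimm ι →
      Function.Involutive ι ∧
      (∀ x : OnePoint ℝ, ι (Jimm.cls x) = Jimm.cls x ↔
        ∃ M : Matrix.ProjGenLinGroup (Fin 2) ℤ, Jimm.IsAltWordPoint M x) ∧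
      (∀ x : OnePoint ℝ, ι (Jimm.cls x) = Jimm.cls x ↔
        ∃ M : Matrix.ProjGenLinGroup (Fin 2) ℤ,
          ¬ IsOfFinOrder (Jimm.jimm M * M) ∧ (Jimm.jimm M * M) • x = x) ∧
      (∀ k : ℕ, ∃ z : ℝ,
        Filter.Tendsto (Jimm.contFrac (Jimm.onesDigits k)).convs Filter.atTop (nhds z) ∧
        ι (Jimm.cls z) = Jimm.cls z ∧
        ∃ x : OnePoint ℝ, Jimm.IsAltWordPoint (Jimm.genT ^ (k + 1)) x ∧
          Jimm.cls x = Jimm.cls z) := by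
  refine ⟨Jimm.existsUnique_isInducedByJimm, fun ι hι => ⟨hι.involutive, fun x => ?_, fun x => ?_,
    fun k => hι.onesDigits k⟩⟩
  · exact ⟨hι.exists_isAltWordPoint, fun ⟨_, h⟩ => hι.eq_of_isAltWordPoint h⟩
  · exact ⟨hι.exists_smul_eq, fun ⟨_, h, hx⟩ => hι.eq_of_smul_eq h hx⟩
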